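/- **Theorem 1.** Let $(\Omega,\mu)$ be a $\sigma$-finite measure space (for instance a $\sigma$-compact topological space with a regular Borel measure), let $K:\Omega\to\mathbb{C}$, and let $(A(u))_{u\in\Omega}$ be a $\mu$-measurable family of pairwise commuting real self-adjoint $n\times n$ matrices, nonsingular for $\mu$-almost every $u$ with $K(u)\neq 0$, such that $|\det A(u)|^{-1/2}K(u)\in L^1(\Omega,\mu)$. Then there are an orthogonal matrix $C$ and real vectors $a(u)=(a_1(u),\dots,a_n(u))$ with $C^{-1}A(u)C=\mathrm{diag}(a_1(u),\dots,a_n(u))$ for all $u\in\Omega$; fix any such $C$ and $a$, and any enumeration $U_1,\dots,U_{2^n}$ of the open hyperoctants of $\mathbb{R}^n$. For $1\le i,j\le 2^n$ let $\varepsilon(i;j)\in\{-1,1\}^n$ be the sign vector with $\varepsilon(i;j)U_i=U_j$ (coordinatewise product), let $\Omega_{ij}=\{u\in\Omega:(\mathrm{sgn}\,a_1(u),\dots,\mathrm{sgn}\,a_n(u))=\varepsilon(i;j)\}$, and define the matrix symbol $\Phi=(\varphi_{ij})_{i,j=1}^{2^n}$ by $$\varphi_{ij}(s)=\int_{\Omega_{ij}}K(u)\prod_{k=1}^n|a_k(u)|^{-1/2-\mathrm{i}s_k}\,d\mu(u),\qquad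 s\in\mathbb{R}^n.$$ Then: 1. The Hausdorff operator $(\mathcal{H}f)(x)=\int_\Omega K(u)f(A(u)x)\,d\mu(u)$ is a well-defined bounded operator on $L^2(\mathbb{R}^n)$ (for each $f\in L^2(\mathbb{R}^n)$ the integral converges absolutely for almost every $x$), and it is normal. 2. Each matrix $\Phi(s)$ is normal, and $\mathcal{H}$ is unitarily equivalent to the operator $M_\Phi$ of multiplication by $\Phi$ in $L^2(\mathbb{R}^n;\mathbb{C}^{2^n})$: $\mathcal{V}\mathcal{H}\mathcal{V}^{-1}=M_\Phi$ for a unitary $\mathcal{V}:L^2(\mathbb{R}^n)\to L^2(\mathbb{R}^n;\mathbb{C}^{2^n})$ given by the hyperoctant-wise Mellin transforms $$(\mathcal{V}f)_i(s)=\frac{1}{(2\pi)^{n/2}}\int_{U_i}\prod_{k=1}^n|x_k|^{-1/2+\mathrm{i}s_k}\,f(Cx)\,dx\quad\text{for a.e. } s\in\mathbb{R}^n,$$ for all $i$ and all $f\in L^2(\mathbb{R}^n)$ for which this integral converges absolutely. 3. The entries $\varphi_{ij}$ belong to the algebra $C_b(\mathbb{R}^n)$ of bounded continuous functions, and the spectrum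 of $\mathcal{H}$ equals the spectrum of $\Phi$ in the matrix algebra $\mathrm{Mat}_{2^n}(C_b(\mathbb{R}^n))$; in other words, $$\sigma(\mathcal{H})=\Big\{\lambda\in\mathbb{C}:\inf_{s\in\mathbb{R}^n}|\det(\lambda-\Phi(s))|=0\Big\}.$$ 4. The point spectrum of $\mathcal{H}$ (the set of its eigenvalues) consists of those $\lambda\in\mathbb{C}$ for which the closed set $E(\lambda)=\{s\in\mathbb{R}^n:\det(\lambda-\Phi(s))=0\}$ has positive Lebesgue measure. 5. The residual spectrum of $\mathcal{H}$ (the set of $\lambda\in\sigma(\mathcal{H})$ for which $\lambda-\mathcal{H}$ is injective with non-dense range) is empty. -/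

import Mathlib

open MeasureTheory

open scoped BoundedContinuousFunction Matrix

noncomputable section

namespace Hausdorff

/-- The Euclidean space `ℝⁿ` (with Lebesgue measure as its `volume`). -/
abbrev E (n : ℕ) : Type := EuclideanSpace ℝ (Fin n)

/-- The space `L²(ℝⁿ)` of complex-valued functions. -/
abbrev L2 (n : ℕ) : Type := Lp ℂ 2 (volume : Measure (E n))

/-- The Hilbert space `ℂ^{2ⁿ}`. -/
abbrev CVec (n : ℕ) : Type := EuclideanSpace ℂ (Fin (2 ^ n))

/-- The space `L²(ℝⁿ; ℂ^{2ⁿ})`. -/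
abbrev L2Vec (n : ℕ) : Type := Lp (CVec n) 2 (volume : Measure (E n))

/-- The linear action `x ↦ B x` of a real matrix on column vectors of `ℝⁿ`. -/
def act {n : ℕ} (B : Matrix (Fin n) (Fin n) ℝ) (x : E n) : E n :=
  WithLp.toLp 2 (B *ᵥ (WithLp.ofLp x))

/-- The bounded operator `H` on `L²(ℝⁿ)` is the Hausdorff operator
`(H f)(x) = ∫ K(u) f(A(u) x) dμ(u)`: for every `f ∈ L²` the integral converges absolutely
for almost every `x`, and its value is `(H f)(x)` for almost every `x`. -/
def IsHausdorffOperator {Ω : Type*} [MeasurableSpace Ω] (μ : Measure Ω) {n : ℕ} (K : Ω → ℂ)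
    (A : Ω → Matrix (Fin n) (Fin n) ℝ) (H : L2 n →L[ℂ] L2 n) : Prop :=
  ∀ f : L2 n, ∀ᵐ x : E n,
    Integrable (fun u => K u * f (act (A u) x)) μ ∧ H f x = ∫ u, K u * f (act (A u) x) ∂μ

/-- `|x|^z = ∏ₖ |xₖ|^{zₖ}`, where `|xₖ|^{zₖ} = exp (zₖ log |xₖ|)`
(only used when all `xₖ` are nonzero). -/
def absPow {n : ℕ} (x : Fin n → ℝ) (z : Fin n → ℂ) : ℂ :=
  ∏ k, Complex.exp (z k * (Real.log |x k| : ℂ))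

/-- The open hyperoctant of `ℝⁿ` with sign vector `σ ∈ {-1, 1}ⁿ`. -/
def hyperoctant {n : ℕ} (σ : Fin n → ℤˣ) : Set (E n) :=
  {x | ∀ k, Real.sign (x k) = (((σ k : ℤˣ) : ℤ) : ℝ)}

/-- The unique sign vector `ε(i; j)` with `ε(i; j) Uᵢ = Uⱼ`, for the enumeration
`j ↦ Uⱼ = hyperoctant (e j)` of the hyperoctants. -/
def eps {n : ℕ} (e : Fin (2 ^ n) ≃ (Fin n → ℤˣ)) (i j : Fin (2 ^ n)) : Fin n → ℤˣ :=
  fun k => e j k * (e i k)⁻¹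

/-- The set `Ωᵢⱼ` of those `u` for which the signs of `a₁(u), …, aₙ(u)` are `ε(i; j)`. -/
def signSet {Ω : Type*} {n : ℕ} (a : Ω → Fin n → ℝ) (e : Fin (2 ^ n) ≃ (Fin n → ℤˣ))
    (i j : Fin (2 ^ n)) : Set Ω :=
  {u | ∀ k, Real.sign (a u k) = (((eps e i j k : ℤˣ) : ℤ) : ℝ)}

/-- The matrix symbol `Φ(s) = (φᵢⱼ(s))`, with
`φᵢⱼ(s) = ∫_{Ωᵢⱼ} K(u) |a(u)|^{-1/2 - i s} dμ(u)`. -/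
def symbol {Ω : Type*} [MeasurableSpace Ω] (μ : Measure Ω) {n : ℕ} (K : Ω → ℂ)
    (a : Ω → Fin n → ℝ) (e : Fin (2 ^ n) ≃ (Fin n → ℤˣ)) (s : E n) :
    Matrix (Fin (2 ^ n)) (Fin (2 ^ n)) ℂ :=
  Matrix.of fun i j =>
    ∫ u in signSet a e i j, K u * absPow (a u) (fun k => -(1 / 2 : ℂ) - Complex.I * (s k : ℂ)) ∂μ

/-- The modified `n`-dimensional Mellin transform for the hyperoctant with sign vector `σ`:
`(2π)^{-n/2} ∫_U |x|^{-1/2 + i s} g(x) dx`. -/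
def mellin {n : ℕ} (σ : Fin n → ℤˣ) (g : E n → ℂ) (s : E n) : ℂ :=
  (((2 * Real.pi) ^ (-(n : ℝ) / 2) : ℝ) : ℂ) *
    ∫ x in hyperoctant σ, absPow x (fun k => -(1 / 2 : ℂ) + Complex.I * (s k : ℂ)) * g x

/-- The map `V : L²(ℝⁿ) → L²(ℝⁿ; ℂ^{2ⁿ})` is the hyperoctant-wise Mellin transform in the
coordinates given by `C`: its `i`-th component is the Mellin transform over the `i`-th
hyperoctant of `x ↦ f (C x)`, whenever the Mellin integral converges absolutely.
(Such `f` are dense, so this determines a bounded `V`.) -/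
def IsMellinTransform {n : ℕ} (C : Matrix (Fin n) (Fin n) ℝ) (e : Fin (2 ^ n) ≃ (Fin n → ℤˣ))
    (V : L2 n → L2Vec n) : Prop :=
  ∀ (f : L2 n) (i : Fin (2 ^ n)),
    IntegrableOn (fun x : E n => absPow x (fun _ => -(1 / 2 : ℂ)) * f (act C x))
      (hyperoctant (e i)) →
    ∀ᵐ s : E n, V f s i = mellin (e i) (fun x => f (act C x)) s

/-- `M` is the operator of multiplication by the matrix function `Φ` in `L²(ℝⁿ; ℂ^{2ⁿ})`. -/
def IsMultiplicationOperator {n : ℕ} (Φ : E n → Matrix (Fin (2 ^ n)) (Fin (2 ^ n)) ℂ)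
    (M : L2Vec n →L[ℂ] L2Vec n) : Prop :=
  ∀ g : L2Vec n, ∀ᵐ s : E n, M g s = WithLp.toLp 2 (Φ s *ᵥ (WithLp.ofLp (g s)))

/-- The point spectrum: the set of eigenvalues. -/
def pointSpectrum {X : Type*} [NormedAddCommGroup X] [NormedSpace ℂ X] (T : X →L[ℂ] X) : Set ℂ :=
  {z | ∃ f : X, f ≠ 0 ∧ T f = z • f}

/-- The residual spectrum: those `z` in the spectrum for which `z - T` is injective
and does not have dense range. -/
def residualSpectrum {X : Type*} [NormedAddCommGroup X] [NormedSpace ℂ X] (T : X →L[ℂ] X) :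
    Set ℂ :=
  {z | z ∈ spectrum ℂ T ∧ Function.Injective (fun f : X => z • f - T f) ∧
    ¬ DenseRange (fun f : X => z • f - T f)}

end Hausdorff

end

/-! The matrices `A u` are diagonalized by one orthogonal `C`. In the coordinates `x k = ± exp (2π t
k)` on each hyperoctant, weighted by the square root of the Jacobian, a scalar `L²` function becomes
a `ℂ^{2ⁿ}`-valued one. The unitary dilation `f ↦ |det A u|^{1/2} f (A u x)` then becomes a
translation by `log |a u k| / 2π` together with the permutation of hyperoctants given by the signs
of `a u`. The inverse Fourier transform turns the translation into a phase, so each dilation becomes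
multiplication by the matrix `dilMat` (`mellinUnitary_dilation`). The Hausdorff operator is a
superposition of these dilations with the `L¹` weight `|det A u|^{-1/2} K u`. Integrating `dilMat`
against that weight yields the symbol (`symbol_eq_integral`), and a weak Fubini argument yields the
intertwining relation (`mellinUnitary_hausdorff`).

What remains concerns multiplication by a matrix `Φ` over bounded continuous functions. The symbol
is normal because its entries depend only on a quotient in a commutative group
(`isStarNormal_group_matrix`). For the spectrum, three inclusions close a cycle: the spectrum of the
operator lies in that of `Φ`, since `mulOpHom` is an algebra homomorphism; that lies in the set
where `inf |det (z - Φ)| = 0`, since a determinant bounded away from zero is invertible; and this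
set lies in the spectrum of the operator, since a bounded inverse gives a uniform lower bound on the
determinant (`subset_spectrum_mulOp`). Eigenvalues are detected through the Cayley–Hamilton theorem
rather than a measurable choice of kernel vectors (`measure_det_eq_zero_of_mulOp_injective`).
Normality alone excludes residual spectrum. -/

namespace Hausdorff

/-! ### The inverse Fourier transform on vector-valued `L²`. -/

section FourierL2

open FourierTransform Filter
open scoped SchwartzMap ContDiff RealInnerProductSpace

variable {X F G : Type*} [NormedAddCommGroup X] [InnerProductSpace ℝ X] [FiniteDimensional ℝ X]
  [MeasurableSpace X] [BorelSpace X]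
  [NormedAddCommGroup F] [InnerProductSpace ℂ F] [CompleteSpace F]
  [NormedAddCommGroup G] [InnerProductSpace ℂ G] [CompleteSpace G]

/-- The `L²` transform agrees with that of tempered distributions, which is defined by duality. This
is how the identities for `𝓕⁻` below are tested. -/
theorem integral_smul_fourierInv_Lp (f : Lp F 2 (volume : Measure X)) {φ : X → ℂ}
    (hφ : HasCompactSupport φ) (hφ' : ContDiff ℝ ∞ φ) :
    ∫ x, φ x • (𝓕⁻ f : Lp F 2 (volume : Measure X)) x = ∫ x, (𝓕⁻ φ) x • f x := by
  have h := DFunLike.congr_fun (Lp.fourierInv_toTemperedDistribution_eq f)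
    (hφ.toSchwartzMap hφ')
  rw [TemperedDistribution.fourierInv_apply, Lp.toTemperedDistribution_apply,
    Lp.toTemperedDistribution_apply] at h
  simp only [SchwartzMap.fourierInv_coe] at h
  exact h.symm

theorem Lp_ae_eq_of_integral_smul {f g : X → F} (hf : LocallyIntegrable f)
    (hg : LocallyIntegrable g)
    (h : ∀ φ : X → ℂ, HasCompactSupport φ → ContDiff ℝ ∞ φ →
      ∫ x, φ x • f x = ∫ x, φ x • g x) : f =ᵐ[volume] g := by
  refine ae_eq_of_integral_contDiff_smul_eq hf hg fun φ hφ hφ' ↦ ?_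
  have := h (Complex.ofRealCLM ∘ φ) (hφ'.comp_left rfl) (by fun_prop)
  simpa using this

theorem integrable_of_compact_contDiff {φ : X → ℂ} (hφ : HasCompactSupport φ)
    (hφ' : ContDiff ℝ ∞ φ) : Integrable φ :=
  hφ'.continuous.integrable_of_hasCompactSupport hφ

theorem Lp_locallyIntegrable {F : Type*} [NormedAddCommGroup F]
    (f : Lp F 2 (volume : Measure X)) : LocallyIntegrable f volume :=
  (Lp.memLp f).locallyIntegrable (by norm_num)

/-- On integrable functions the inverse `L²` Fourier transform is given by the integral. -/
theorem fourierInv_Lp_ae_eq (f : Lp F 2 (volume : Measure X)) (hf : Integrable f) :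
    (𝓕⁻ f : Lp F 2 (volume : Measure X)) =ᵐ[volume] 𝓕⁻ (f : X → F) := by
  have hcont : Continuous (𝓕⁻ (f : X → F)) :=
    VectorFourier.fourierIntegral_continuous (L := -innerₗ X) Real.continuous_fourierChar
      (by simpa using! continuous_inner.neg) hf
  refine Lp_ae_eq_of_integral_smul (Lp_locallyIntegrable _) hcont.locallyIntegrable
    fun φ hφ hφ' ↦ ?_
  rw [integral_smul_fourierInv_Lp f hφ hφ']
  have := VectorFourier.integral_fourierIntegral_smul_eq_flip (L := -innerₗ X)
    (μ := volume) (ν := volume) Real.continuous_fourierChar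
    (by simpa using! continuous_inner.neg) (integrable_of_compact_contDiff hφ hφ') hf
  have hflip : (-innerₗ X).flip = -innerₗ X := by
    ext x y; simp [real_inner_comm]
  rw [hflip] at this
  exact this

/-- Testing moves `𝓕⁻` onto the test function, and `L` commutes with the integral. It is applied to
coordinate projections and to permutations of the coordinates. -/
theorem fourierInv_compLp (L : F →L[ℂ] G) (f : Lp F 2 (volume : Measure X)) :
    (𝓕⁻ (L.compLp f) : Lp G 2 (volume : Measure X)) = L.compLp (𝓕⁻ f) := by
  apply Lp.ext
  refine Lp_ae_eq_of_integral_smul (Lp_locallyIntegrable _) (Lp_locallyIntegrable _)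
    fun φ hφ hφ' ↦ ?_
  rw [integral_smul_fourierInv_Lp _ hφ hφ']
  have h2 : MemLp (𝓕⁻ φ) 2 (volume : Measure X) := by
    have := (𝓕⁻ (hφ.toSchwartzMap hφ')).memLp 2 (volume : Measure X)
    simpa [SchwartzMap.fourierInv_coe] using! this
  have h3 : MemLp φ 2 (volume : Measure X) := (hφ.toSchwartzMap hφ').memLp 2 _
  have e1 : ∫ x, 𝓕⁻ φ x • (L.compLp f) x = ∫ x, L (𝓕⁻ φ x • f x) := by
    refine integral_congr_ae ?_
    filter_upwards [L.coeFn_compLp f] with x hx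
    rw [hx, map_smul]
  have e2 : ∫ x, φ x • (L.compLp (𝓕⁻ f : Lp F 2 (volume : Measure X))) x
      = ∫ x, L (φ x • (𝓕⁻ f : Lp F 2 (volume : Measure X)) x) := by
    refine integral_congr_ae ?_
    filter_upwards [L.coeFn_compLp (𝓕⁻ f : Lp F 2 (volume : Measure X))] with x hx
    rw [hx, map_smul]
  rw [e1, e2, L.integral_comp_comm, L.integral_comp_comm, integral_smul_fourierInv_Lp _ hφ hφ']
  · exact memLp_one_iff_integrable.1 ((Lp.memLp _).smul h3)
  · exact memLp_one_iff_integrable.1 ((Lp.memLp _).smul h2)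

theorem contDiff_fourierChar_inner {X : Type*} [NormedAddCommGroup X] [InnerProductSpace ℝ X]
    (b : X) :
    ContDiff ℝ ∞ fun s : X ↦ ((Real.fourierChar (-⟪b, s⟫) : Circle) : ℂ) := by
  simp only [Real.fourierChar_apply]
  have h : ContDiff ℝ ∞ fun s : X ↦ Complex.ofRealCLM (2 * Real.pi * -⟪b, s⟫) :=
    Complex.ofRealCLM.contDiff.comp (contDiff_const.mul (innerSL ℝ b).contDiff.neg)
  exact Complex.contDiff_exp.comp (h.mul contDiff_const)

/-- The inverse Fourier transform turns translations into modulations. -/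
theorem fourierInv_translate (f g : Lp F 2 (volume : Measure X)) (b : X)
    (h : g =ᵐ[volume] fun x ↦ f (x + b)) :
    (𝓕⁻ g : Lp F 2 (volume : Measure X)) =ᵐ[volume]
      fun s ↦ ((Real.fourierChar (-⟪b, s⟫) : Circle) : ℂ) •
        (𝓕⁻ f : Lp F 2 (volume : Measure X)) s := by
  have hc := (contDiff_fourierChar_inner b).continuous
  have hloc : LocallyIntegrable (fun s ↦ ((Real.fourierChar (-⟪b, s⟫) : Circle) : ℂ) •
        (𝓕⁻ f : Lp F 2 (volume : Measure X)) s) := by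
    refine MemLp.locallyIntegrable (p := 2) ?_ (by norm_num)
    refine (Lp.memLp (𝓕⁻ f : Lp F 2 (volume : Measure X))).of_le
      (hc.aestronglyMeasurable.smul (Lp.aestronglyMeasurable _)) (ae_of_all _ fun x ↦ ?_)
    rw [norm_smul, Circle.norm_coe, one_mul]
  refine Lp_ae_eq_of_integral_smul (Lp_locallyIntegrable _) hloc fun φ hφ hφ' ↦ ?_
  rw [integral_smul_fourierInv_Lp _ hφ hφ']
  simp only [smul_smul]
  -- The character is smooth, so the modulated `φ` is still an admissible test function. Its
  -- transform is a shift of `𝓕⁻ φ`, which translation invariance undoes.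
  have := integral_smul_fourierInv_Lp f
    (φ := fun s ↦ φ s * ((Real.fourierChar (-⟪b, s⟫) : Circle) : ℂ))
    (hφ.mul_right) (hφ'.mul (contDiff_fourierChar_inner b))
  rw [this]
  have e1 : ∫ x, 𝓕⁻ φ x • g x = ∫ x, 𝓕⁻ φ x • f (x + b) := by
    refine integral_congr_ae ?_
    filter_upwards [h] with x hx
    rw [hx]
  rw [e1]
  conv_rhs => rw [← integral_add_right_eq_self _ b]
  congr 1; ext x
  congr 1
  rw [Real.fourierInv_eq, Real.fourierInv_eq]
  congr 1; ext v
  rw [inner_add_right, AddChar.map_add_eq_mul, Circle.smul_def, Circle.smul_def,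
    AddChar.map_neg_eq_inv, real_inner_comm b v]
  simp only [Circle.coe_mul, Circle.coe_inv, smul_eq_mul]
  have : ((Real.fourierChar ⟪b, v⟫ : Circle) : ℂ) ≠ 0 := Circle.coe_ne_zero _
  field_simp

end FourierL2

theorem eLpNorm_two_sq {X F : Type*} [MeasurableSpace X] [NormedAddCommGroup F]
    {ν : Measure X} (f : X → F) : eLpNorm f 2 ν ^ 2 = ∫⁻ x, ‖f x‖ₑ ^ 2 ∂ν := by
  have := eLpNorm_nnreal_pow_eq_lintegral (f := f) (μ := ν) (p := 2) two_ne_zero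
  simpa [ENNReal.rpow_two] using this

/-! ### Superpositions `∫ k(u) G(u, ·) dμ(u)` of `L²` functions. -/

section Superposition

open scoped ENNReal

/-- Cauchy–Schwarz for `k^{1/2}` and `k^{1/2} g`. -/
theorem lintegral_mul_sq_le {Ω : Type*} [MeasurableSpace Ω] {μ : Measure Ω} {k g : Ω → ℝ≥0∞}
    (hk : AEMeasurable k μ) (hg : AEMeasurable g μ) :
    (∫⁻ u, k u * g u ∂μ) ^ 2 ≤ (∫⁻ u, k u ∂μ) * ∫⁻ u, k u * g u ^ 2 ∂μ := by
  have h := ENNReal.lintegral_mul_le_Lp_mul_Lq μ Real.HolderConjugate.two_two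
    (f := fun u ↦ k u ^ (1 / 2 : ℝ)) (g := fun u ↦ k u ^ (1 / 2 : ℝ) * g u)
    (by fun_prop) (by fun_prop)
  have hs : ∀ x : ℝ≥0∞, x ^ (1 / 2 : ℝ) * x ^ (1 / 2 : ℝ) = x := fun x ↦ by
    rw [← ENNReal.rpow_add_of_nonneg _ _ (by norm_num) (by norm_num)]; norm_num
  have hs2 : ∀ x : ℝ≥0∞, (x ^ (1 / 2 : ℝ)) ^ (2 : ℝ) = x := fun x ↦ by
    rw [← ENNReal.rpow_mul]; norm_num
  simp only [Pi.mul_apply, ← mul_assoc, hs, ENNReal.mul_rpow_of_nonneg _ _ zero_le_two, hs2] at h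
  calc _ ≤ _ := pow_le_pow_left' h 2
    _ = _ := by
      rw [mul_pow, ← ENNReal.rpow_natCast, ← ENNReal.rpow_natCast]
      simp only [Nat.cast_ofNat, hs2, ENNReal.rpow_two]

variable {Ω X F : Type*} [MeasurableSpace Ω] [MeasurableSpace X] {μ : Measure Ω} {ν : Measure X}
  [SigmaFinite μ] [SigmaFinite ν] [NormedAddCommGroup F]
  {k : Ω → ℂ} {G : Ω → X → F} {R : ℝ≥0∞}

/-- A Minkowski-type bound: Cauchy–Schwarz at each `x`, then Tonelli so that the uniform bound in
`u` can be used. -/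
theorem lintegral_sq_lintegral_le (hk : AEStronglyMeasurable k μ)
    (hG : AEStronglyMeasurable (Function.uncurry G) (μ.prod ν))
    (hR : ∀ᵐ u ∂μ, ∫⁻ x, ‖G u x‖ₑ ^ 2 ∂ν ≤ R) :
    ∫⁻ x, (∫⁻ u, ‖k u‖ₑ * ‖G u x‖ₑ ∂μ) ^ 2 ∂ν ≤ (∫⁻ u, ‖k u‖ₑ ∂μ) ^ 2 * R := by
  have hmeas : AEMeasurable (fun p : X × Ω ↦ ‖k p.2‖ₑ * ‖G p.2 p.1‖ₑ ^ 2) (ν.prod μ) :=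
    (hk.comp_snd.enorm).mul (hG.prod_swap.enorm.pow_const 2)
  calc ∫⁻ x, (∫⁻ u, ‖k u‖ₑ * ‖G u x‖ₑ ∂μ) ^ 2 ∂ν
      ≤ ∫⁻ x, (∫⁻ u, ‖k u‖ₑ ∂μ) * ∫⁻ u, ‖k u‖ₑ * ‖G u x‖ₑ ^ 2 ∂μ ∂ν := by
        refine lintegral_mono_ae ?_
        filter_upwards [hG.prod_swap.prodMk_left] with x hx
        exact lintegral_mul_sq_le hk.enorm hx.enorm
    _ = (∫⁻ u, ‖k u‖ₑ ∂μ) * ∫⁻ x, ∫⁻ u, ‖k u‖ₑ * ‖G u x‖ₑ ^ 2 ∂μ ∂ν :=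
        lintegral_const_mul'' _ hmeas.lintegral_prod_right'
    _ = (∫⁻ u, ‖k u‖ₑ ∂μ) * ∫⁻ u, ∫⁻ x, ‖k u‖ₑ * ‖G u x‖ₑ ^ 2 ∂ν ∂μ := by
        rw [lintegral_lintegral_swap hmeas]
    _ ≤ (∫⁻ u, ‖k u‖ₑ ∂μ) * ∫⁻ u, ‖k u‖ₑ * R ∂μ := by
        refine mul_le_mul_right (lintegral_mono_ae ?_) _
        filter_upwards [hR, hG.prodMk_left] with u hu hu'
        refine (lintegral_const_mul'' _ (hu'.enorm.pow_const 2)).trans_le ?_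
        exact mul_le_mul_right hu _
    _ = _ := by rw [lintegral_mul_const'' _ hk.enorm]; ring

variable [NormedSpace ℂ F]

theorem ae_integrable_superposition (hk : Integrable k μ)
    (hG : AEStronglyMeasurable (Function.uncurry G) (μ.prod ν)) (hR' : R ≠ ∞)
    (hR : ∀ᵐ u ∂μ, ∫⁻ x, ‖G u x‖ₑ ^ 2 ∂ν ≤ R) :
    ∀ᵐ x ∂ν, Integrable (fun u ↦ k u • G u x) μ := by
  have hmeas : AEMeasurable (fun p : X × Ω ↦ ‖k p.2‖ₑ * ‖G p.2 p.1‖ₑ) (ν.prod μ) :=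
    (hk.1.comp_snd.enorm).mul hG.prod_swap.enorm
  have h := lintegral_sq_lintegral_le hk.1 hG hR
  have h' := ae_lt_top' (hmeas.lintegral_prod_right'.pow_const 2) (ne_top_of_le_ne_top
    (ENNReal.mul_ne_top (ENNReal.pow_ne_top hk.2.ne) hR') h)
  filter_upwards [h', hG.prod_swap.prodMk_left] with x hx hx'
  refine ⟨hk.1.smul hx', ?_⟩
  rw [hasFiniteIntegral_iff_enorm]
  simp only [enorm_smul]
  simpa using hx

theorem aestronglyMeasurable_superposition (hk : Integrable k μ)
    (hG : AEStronglyMeasurable (Function.uncurry G) (μ.prod ν)) :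
    AEStronglyMeasurable (fun x ↦ ∫ u, k u • G u x ∂μ) ν :=
  (hk.1.comp_snd.smul hG.prod_swap).integral_prod_right'

theorem lintegral_sq_superposition_le (hk : Integrable k μ)
    (hG : AEStronglyMeasurable (Function.uncurry G) (μ.prod ν))
    (hR : ∀ᵐ u ∂μ, ∫⁻ x, ‖G u x‖ₑ ^ 2 ∂ν ≤ R) :
    ∫⁻ x, ‖∫ u, k u • G u x ∂μ‖ₑ ^ 2 ∂ν ≤ (∫⁻ u, ‖k u‖ₑ ∂μ) ^ 2 * R := by
  refine le_trans (lintegral_mono fun x ↦ ?_) (lintegral_sq_lintegral_le hk.1 hG hR)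
  refine pow_le_pow_left' ((enorm_integral_le_lintegral_enorm _).trans_eq ?_) 2
  simp only [enorm_smul]

end Superposition

section SuperpositionInner

open scoped ENNReal InnerProductSpace

variable {Ω X F : Type*} [MeasurableSpace Ω] [MeasurableSpace X] {μ : Measure Ω} {ν : Measure X}
  [SigmaFinite μ] [SigmaFinite ν] [NormedAddCommGroup F] [InnerProductSpace ℂ F] [CompleteSpace F]
  {k : Ω → ℂ} {G : Ω → X → F} {R : ℝ≥0∞}

/-- Fubini in weak form, which spares integrals of `L²`-valued functions of `u`. Absolute
integrability on the product comes from Hölder and `lintegral_sq_lintegral_le`. -/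
theorem integral_inner_superposition (hk : Integrable k μ)
    (hG : AEStronglyMeasurable (Function.uncurry G) (μ.prod ν)) (hR' : R ≠ ∞)
    (hR : ∀ᵐ u ∂μ, ∫⁻ x, ‖G u x‖ₑ ^ 2 ∂ν ≤ R) {h : X → F} (hh : MemLp h 2 ν) :
    ∫ x, ⟪h x, ∫ u, k u • G u x ∂μ⟫_ℂ ∂ν = ∫ u, ∫ x, ⟪h x, k u • G u x⟫_ℂ ∂ν ∂μ := by
  have hint : Integrable (fun p : X × Ω ↦ ⟪h p.1, k p.2 • G p.2 p.1⟫_ℂ) (ν.prod μ) := by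
    refine ⟨hh.1.comp_fst.inner (hk.1.comp_snd.smul hG.prod_swap), ?_⟩
    have hmeas : AEMeasurable (fun p : X × Ω ↦ ‖k p.2‖ₑ * ‖G p.2 p.1‖ₑ) (ν.prod μ) :=
      (hk.1.comp_snd.enorm).mul hG.prod_swap.enorm
    have hmeas2 : AEMeasurable (fun p : X × Ω ↦ ‖h p.1‖ₑ * (‖k p.2‖ₑ * ‖G p.2 p.1‖ₑ))
      (ν.prod μ) := hh.1.comp_fst.enorm.mul hmeas
    rw [hasFiniteIntegral_iff_enorm]
    calc _ ≤ ∫⁻ p : X × Ω, ‖h p.1‖ₑ * (‖k p.2‖ₑ * ‖G p.2 p.1‖ₑ) ∂(ν.prod μ) := by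
          refine lintegral_mono fun p ↦ ?_
          rw [← enorm_smul (k p.2)]
          exact ENNReal.coe_le_coe.2 (nnnorm_inner_le_nnnorm (𝕜 := ℂ) (h p.1) (k p.2 • G p.2 p.1))
      _ = ∫⁻ x, ‖h x‖ₑ * ∫⁻ u, ‖k u‖ₑ * ‖G u x‖ₑ ∂μ ∂ν := by
          rw [lintegral_prod _ hmeas2]
          refine lintegral_congr_ae ?_
          filter_upwards [hG.prod_swap.prodMk_left] with x hx
          exact lintegral_const_mul'' _ (hk.1.enorm.mul hx.enorm)
      _ < ∞ := by
          have := ENNReal.lintegral_mul_le_Lp_mul_Lq ν Real.HolderConjugate.two_two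
            hh.1.enorm hmeas.lintegral_prod_right'
          refine lt_of_le_of_lt this (ENNReal.mul_lt_top ?_ ?_)
          · refine ENNReal.rpow_lt_top_of_nonneg (by norm_num) ?_
            simp only [ENNReal.rpow_two, ← eLpNorm_two_sq]
            exact ENNReal.pow_ne_top hh.2.ne
          · refine ENNReal.rpow_lt_top_of_nonneg (by norm_num) ?_
            simp only [ENNReal.rpow_two]
            exact ne_top_of_le_ne_top (ENNReal.mul_ne_top (ENNReal.pow_ne_top hk.2.ne) hR')
              (lintegral_sq_lintegral_le hk.1 hG hR)
  rw [← integral_integral_swap hint]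
  refine integral_congr_ae ?_
  filter_upwards [ae_integrable_superposition hk hG hR' hR] with x hx
  exact (integral_inner hx _).symm

end SuperpositionInner

/-! ### Multiplication operators by matrices of bounded continuous functions. -/

section MatrixSymbols

variable {X ι : Type*} [TopologicalSpace X] [Fintype ι] [DecidableEq ι]

/-- Evaluation at a point, as a homomorphism from matrices over the bounded continuous functions
to complex matrices. -/
noncomputable def evalMat (s : X) : Matrix ι ι (X →ᵇ ℂ) →+* Matrix ι ι ℂ :=
  RingHom.mapMatrix
    { toFun := fun f ↦ f s
      map_one' := rfl
      map_mul' := fun _ _ ↦ rfl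
      map_zero' := rfl
      map_add' := fun _ _ ↦ rfl }

@[simp] theorem evalMat_apply (s : X) (Φ : Matrix ι ι (X →ᵇ ℂ)) (i j : ι) :
    evalMat s Φ i j = Φ i j s := rfl

theorem evalMat_algebraMap (s : X) (z : ℂ) :
    evalMat (ι := ι) s (algebraMap ℂ _ z) = z • (1 : Matrix ι ι ℂ) := by
  ext i j
  by_cases h : i = j
  · subst h; simp [Matrix.algebraMap_matrix_apply]
  · simp [Matrix.algebraMap_matrix_apply, h]

theorem evalMat_conjTranspose (s : X) (Φ : Matrix ι ι (X →ᵇ ℂ)) :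
    evalMat s Φᴴ = (evalMat s Φ)ᴴ := by
  ext i j; rfl

theorem det_evalMat (s : X) (Φ : Matrix ι ι (X →ᵇ ℂ)) : (evalMat s Φ).det = Φ.det s :=
  (RingHom.map_det _ Φ).symm

theorem norm_toLp_mulVec_le (A : Matrix ι ι ℂ) (v : EuclideanSpace ℂ ι) :
    ‖(WithLp.toLp 2 (A *ᵥ WithLp.ofLp v) : EuclideanSpace ℂ ι)‖ ≤ (∑ i, ∑ j, ‖A i j‖) * ‖v‖ := by
  have h1 : (WithLp.toLp 2 (A *ᵥ WithLp.ofLp v) : EuclideanSpace ℂ ι)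
      = ∑ i, EuclideanSpace.single i ((A *ᵥ WithLp.ofLp v) i) := by
    ext k; simp [Finset.sum_apply, Pi.single_apply]
  rw [h1, Finset.sum_mul]
  refine (norm_sum_le _ _).trans (Finset.sum_le_sum fun i _ ↦ ?_)
  rw [PiLp.norm_single, Finset.sum_mul]
  refine (norm_sum_le _ _).trans (Finset.sum_le_sum fun j _ ↦ ?_)
  rw [norm_mul]
  exact mul_le_mul_of_nonneg_left (PiLp.norm_apply_le v j) (norm_nonneg _)

theorem norm_evalMat_mulVec_le (Φ : Matrix ι ι (X →ᵇ ℂ)) (s : X) (v : EuclideanSpace ℂ ι) :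
    ‖(WithLp.toLp 2 (evalMat s Φ *ᵥ WithLp.ofLp v) : EuclideanSpace ℂ ι)‖ ≤
      (∑ i, ∑ j, ‖Φ i j‖) * ‖v‖ := by
  refine (norm_toLp_mulVec_le _ v).trans (mul_le_mul_of_nonneg_right ?_ (norm_nonneg _))
  exact Finset.sum_le_sum fun i _ ↦ Finset.sum_le_sum fun j _ ↦ (Φ i j).norm_coe_le_norm s

theorem continuous_evalMat_mulVec (Φ : Matrix ι ι (X →ᵇ ℂ)) :
    Continuous fun p : X × EuclideanSpace ℂ ι ↦
      (WithLp.toLp 2 (evalMat p.1 Φ *ᵥ WithLp.ofLp p.2) : EuclideanSpace ℂ ι) := by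
  refine (PiLp.continuous_toLp 2 _).comp (continuous_pi fun i ↦ ?_)
  simp only [Matrix.mulVec, dotProduct, evalMat_apply]
  fun_prop

variable [MeasurableSpace X] [OpensMeasurableSpace X] [SecondCountableTopology X]
  [TopologicalSpace.PseudoMetrizableSpace X] {ν : Measure X}

theorem memLp_mulVec (Φ : Matrix ι ι (X →ᵇ ℂ)) (g : Lp (EuclideanSpace ℂ ι) 2 ν) :
    MemLp (fun s ↦ (WithLp.toLp 2 (evalMat s Φ *ᵥ WithLp.ofLp (g s)) : EuclideanSpace ℂ ι))
      2 ν := by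
  have h : AEStronglyMeasurable (fun s : X ↦ (s, g s)) ν :=
    aestronglyMeasurable_id.prodMk (Lp.aestronglyMeasurable g)
  have h' := (continuous_evalMat_mulVec Φ).comp_aestronglyMeasurable h
  exact MemLp.of_le_mul (Lp.memLp g) h' (ae_of_all _ fun s ↦ norm_evalMat_mulVec_le Φ s (g s))

/-- Multiplication by a matrix of bounded continuous functions, as an operator on `L²`. -/
noncomputable def mulOp (ν : Measure X) (Φ : Matrix ι ι (X →ᵇ ℂ)) :
    Lp (EuclideanSpace ℂ ι) 2 ν →L[ℂ] Lp (EuclideanSpace ℂ ι) 2 ν :=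
  LinearMap.mkContinuous
    { toFun := fun g ↦ (memLp_mulVec Φ g).toLp
      map_add' := fun f g ↦ by
        rw [← MemLp.toLp_add]
        refine MemLp.toLp_congr _ _ ?_
        filter_upwards [Lp.coeFn_add f g] with s hs
        rw [hs]
        simp [Matrix.mulVec_add]
      map_smul' := fun c f ↦ by
        rw [RingHom.id_apply, ← MemLp.toLp_const_smul]
        refine MemLp.toLp_congr _ _ ?_
        filter_upwards [Lp.coeFn_smul c f] with s hs
        rw [hs]
        simp [Matrix.mulVec_smul] }
    (∑ i, ∑ j, ‖Φ i j‖) fun g ↦ by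
      refine Lp.norm_le_mul_norm_of_ae_le_mul ?_
      filter_upwards [(memLp_mulVec Φ g).coeFn_toLp] with s hs
      rw [LinearMap.coe_mk, AddHom.coe_mk, hs]
      exact norm_evalMat_mulVec_le Φ s _

theorem coeFn_mulOp (Φ : Matrix ι ι (X →ᵇ ℂ)) (g : Lp (EuclideanSpace ℂ ι) 2 ν) :
    mulOp ν Φ g =ᵐ[ν] fun s ↦ WithLp.toLp 2 (evalMat s Φ *ᵥ WithLp.ofLp (g s)) :=
  (memLp_mulVec Φ g).coeFn_toLp

theorem mulOp_mul (Φ Ψ : Matrix ι ι (X →ᵇ ℂ)) : mulOp ν (Φ * Ψ) = mulOp ν Φ * mulOp ν Ψ := by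
  ext1 g
  apply Lp.ext
  filter_upwards [coeFn_mulOp (Φ * Ψ) g, coeFn_mulOp Φ (mulOp ν Ψ g), coeFn_mulOp Ψ g]
    with s h1 h2 h3
  rw [h1, show (mulOp ν Φ * mulOp ν Ψ) g = mulOp ν Φ (mulOp ν Ψ g) from rfl, h2, h3]
  simp [Matrix.mulVec_mulVec]

theorem mulOp_add (Φ Ψ : Matrix ι ι (X →ᵇ ℂ)) : mulOp ν (Φ + Ψ) = mulOp ν Φ + mulOp ν Ψ := by
  ext1 g
  apply Lp.ext
  filter_upwards [coeFn_mulOp (Φ + Ψ) g, coeFn_mulOp Φ g, coeFn_mulOp Ψ g,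
    Lp.coeFn_add (mulOp ν Φ g) (mulOp ν Ψ g)] with s h1 h2 h3 h4
  rw [h1, add_apply, h4, Pi.add_apply, h2, h3]
  simp [Matrix.add_mulVec]

theorem mulOp_algebraMap (z : ℂ) :
    mulOp ν (algebraMap ℂ (Matrix ι ι (X →ᵇ ℂ)) z) = algebraMap ℂ _ z := by
  ext1 g
  apply Lp.ext
  filter_upwards [coeFn_mulOp (ν := ν) (algebraMap ℂ (Matrix ι ι (X →ᵇ ℂ)) z) g,
    Lp.coeFn_smul z g] with s h1 h2
  rw [h1, evalMat_algebraMap, Algebra.algebraMap_eq_smul_one,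
    show (z • (1 : Lp (EuclideanSpace ℂ ι) 2 ν →L[ℂ] Lp (EuclideanSpace ℂ ι) 2 ν)) g = z • g from rfl,
    h2]
  simp [Matrix.smul_mulVec]

/-- `mulOp` as a homomorphism of algebras. -/
noncomputable def mulOpHom (ν : Measure X) : Matrix ι ι (X →ᵇ ℂ) →ₐ[ℂ]
    (Lp (EuclideanSpace ℂ ι) 2 ν →L[ℂ] Lp (EuclideanSpace ℂ ι) 2 ν) where
  toFun := mulOp ν
  map_one' := by simpa using mulOp_algebraMap (ν := ν) (X := X) (ι := ι) 1
  map_mul' := mulOp_mul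
  map_zero' := by simpa using mulOp_algebraMap (ν := ν) (X := X) (ι := ι) 0
  map_add' := mulOp_add
  commutes' := mulOp_algebraMap

theorem adjoint_mulOp (Φ : Matrix ι ι (X →ᵇ ℂ)) :
    ContinuousLinearMap.adjoint (mulOp ν Φ) = mulOp ν Φᴴ := by
  symm
  rw [ContinuousLinearMap.eq_adjoint_iff]
  intro f g
  rw [L2.inner_def, L2.inner_def]
  refine integral_congr_ae ?_
  filter_upwards [coeFn_mulOp Φᴴ f, coeFn_mulOp Φ g] with s h1 h2
  rw [h1, h2, evalMat_conjTranspose, EuclideanSpace.inner_eq_star_dotProduct,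
    EuclideanSpace.inner_eq_star_dotProduct]
  simp only [Matrix.star_mulVec, Matrix.conjTranspose_conjTranspose]
  rw [dotProduct_comm, ← Matrix.dotProduct_mulVec, dotProduct_comm]

theorem isStarNormal_mulOp {Φ : Matrix ι ι (X →ᵇ ℂ)} (h : ∀ s, IsStarNormal (evalMat s Φ)) :
    IsStarNormal (mulOp ν Φ) := by
  have hΦ : Φᴴ * Φ = Φ * Φᴴ := by
    ext i j s
    have := (h s).star_comm_self.eq
    rw [Matrix.star_eq_conjTranspose, ← evalMat_conjTranspose, ← map_mul, ← map_mul] at this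
    exact congrFun (congrFun this i) j
  refine ⟨?_⟩
  rw [ContinuousLinearMap.star_eq_adjoint, adjoint_mulOp]
  exact (mulOp_mul _ _).symm.trans ((congrArg _ hΦ).trans (mulOp_mul _ _))

end MatrixSymbols

/-! ### Spectrum, point spectrum and residual spectrum. -/

section Spectrum

open scoped ENNReal

variable {X ι : Type*} [TopologicalSpace X] [Fintype ι] [DecidableEq ι]

theorem isUnit_of_le_norm {f : X →ᵇ ℂ} {δ : ℝ} (hδ : 0 < δ) (h : ∀ s, δ ≤ ‖f s‖) : IsUnit f := by
  have h0 : ∀ s, f s ≠ 0 := fun s ↦ norm_pos_iff.1 (hδ.trans_le (h s))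
  let g : X →ᵇ ℂ := BoundedContinuousFunction.ofNormedAddCommGroup (fun s ↦ (f s)⁻¹)
    (f.continuous.inv₀ h0) δ⁻¹ fun s ↦ by
      rw [norm_inv]; exact inv_anti₀ hδ (h s)
  refine IsUnit.of_mul_eq_one g ?_
  ext s
  exact mul_inv_cancel₀ (h0 s)

theorem evalMat_algebraMap_sub (s : X) (Φ : Matrix ι ι (X →ᵇ ℂ)) (z : ℂ) :
    evalMat s (algebraMap ℂ _ z - Φ) = z • (1 : Matrix ι ι ℂ) - evalMat s Φ := by
  rw [map_sub, evalMat_algebraMap]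

theorem bddBelow_norm_det {X : Type*} (A : X → Matrix ι ι ℂ) :
    BddBelow (Set.range fun s ↦ ‖(A s).det‖) :=
  ⟨0, by rintro _ ⟨s, rfl⟩; exact norm_nonneg _⟩

theorem isClosed_det_eq_zero (Φ : Matrix ι ι (X →ᵇ ℂ)) : IsClosed {s | (evalMat s Φ).det = 0} := by
  simp only [det_evalMat]
  exact isClosed_eq Φ.det.continuous continuous_const

theorem spectrum_matrix_subset (Φ : Matrix ι ι (X →ᵇ ℂ)) :
    spectrum ℂ Φ ⊆ {z | ⨅ s : X, ‖(z • (1 : Matrix ι ι ℂ) - evalMat s Φ).det‖ = 0} := by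
  intro z hz
  by_contra h
  apply hz
  refine (Matrix.isUnit_iff_isUnit_det _).2 ?_
  have hpos : 0 < ⨅ s : X, ‖(z • (1 : Matrix ι ι ℂ) - evalMat s Φ).det‖ :=
    lt_of_le_of_ne (Real.iInf_nonneg fun s ↦ norm_nonneg _) (Ne.symm h)
  refine isUnit_of_le_norm hpos fun s ↦ ?_
  rw [← det_evalMat, evalMat_algebraMap_sub]
  exact ciInf_le (bddBelow_norm_det _) s

/-- The lower bound makes `A` invertible with the entries of `A⁻¹` at most `c⁻¹`, so the Leibniz
formula bounds `det A⁻¹` from above. -/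
theorem norm_det_ge_of_bound {c : ℝ} (hc : 0 < c) {A : Matrix ι ι ℂ}
    (h : ∀ v : EuclideanSpace ℂ ι,
      c * ‖v‖ ≤ ‖(WithLp.toLp 2 (A *ᵥ WithLp.ofLp v) : EuclideanSpace ℂ ι)‖) :
    (((Fintype.card ι).factorial : ℝ) * c⁻¹ ^ Fintype.card ι)⁻¹ ≤ ‖A.det‖ := by
  have hinj : Function.Injective A.mulVec := by
    refine (injective_iff_map_eq_zero (Matrix.mulVecLin A)).2 fun v hv ↦ ?_
    have := h (WithLp.toLp 2 v)
    rw [Matrix.mulVecLin_apply] at hv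
    simp only [hv, WithLp.toLp_zero, norm_zero] at this
    have h0 : ‖(WithLp.toLp 2 v : EuclideanSpace ℂ ι)‖ = 0 :=
      le_antisymm (by nlinarith [norm_nonneg (WithLp.toLp 2 v : EuclideanSpace ℂ ι)])
        (norm_nonneg _)
    simpa using h0
  have hA : IsUnit A := Matrix.mulVec_injective_iff_isUnit.1 hinj
  have hdet : IsUnit A.det := (Matrix.isUnit_iff_isUnit_det A).1 hA
  have hentry : ∀ i j, ‖A⁻¹ i j‖ ≤ c⁻¹ := fun i j ↦ by
    have h1 := h (WithLp.toLp 2 (A⁻¹ *ᵥ Pi.single j 1))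
    simp only [Matrix.mulVec_mulVec, Matrix.mul_nonsing_inv A hdet, Matrix.one_mulVec] at h1
    rw [show (WithLp.toLp 2 (Pi.single j 1) : EuclideanSpace ℂ ι) = EuclideanSpace.single j 1
      from rfl, PiLp.norm_single, norm_one] at h1
    have h2 : ‖A⁻¹ i j‖ ≤ ‖(WithLp.toLp 2 (A⁻¹ *ᵥ Pi.single j 1) : EuclideanSpace ℂ ι)‖ := by
      have := PiLp.norm_apply_le (WithLp.toLp 2 (A⁻¹ *ᵥ Pi.single j 1) : EuclideanSpace ℂ ι) i
      simpa using this
    refine (le_inv_mul_iff₀ hc).2 ?_ |>.trans_eq (mul_one _)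
    nlinarith
  have hle : ‖A⁻¹.det‖ ≤ ((Fintype.card ι).factorial : ℝ) * c⁻¹ ^ Fintype.card ι := by
    have := Matrix.det_le (abv := NormedField.toAbsoluteValue ℂ) (A := A⁻¹) hentry
    simpa [nsmul_eq_mul] using! this
  have hmul : ‖A.det‖ * ‖A⁻¹.det‖ = 1 := by
    rw [← norm_mul, ← Matrix.det_mul, Matrix.mul_nonsing_inv A hdet]; simp
  have hpos : 0 < ‖A⁻¹.det‖ := by
    rcases (norm_nonneg A⁻¹.det).eq_or_lt with h0 | h0
    · rw [← h0] at hmul; simp at hmul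
    · exact h0
  rw [eq_inv_of_mul_eq_one_left hmul]
  exact inv_anti₀ hpos hle

variable [MeasurableSpace X] [OpensMeasurableSpace X] [SecondCountableTopology X]
  [TopologicalSpace.PseudoMetrizableSpace X] {ν : Measure X}

theorem mulOp_algebraMap_sub (z : ℂ) (Φ : Matrix ι ι (X →ᵇ ℂ)) :
    mulOp ν (algebraMap ℂ _ z - Φ) = algebraMap ℂ _ z - mulOp ν Φ := by
  have := map_sub (mulOpHom ν) (algebraMap ℂ _ z) Φ
  rw [AlgHom.commutes] at this
  exact this

/-- If the bound failed at `s`, continuity would make it fail near `s` for the same `v`, and the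
constant `v` cut off to a small neighbourhood would violate the operator bound. -/
theorem evalMat_bounded_below [ν.IsOpenPosMeasure] [IsLocallyFiniteMeasure ν] {c : ℝ}
    {Φ : Matrix ι ι (X →ᵇ ℂ)} (h : ∀ g, c * ‖g‖ ≤ ‖mulOp ν Φ g‖) (s : X)
    (v : EuclideanSpace ℂ ι) :
    c * ‖v‖ ≤ ‖(WithLp.toLp 2 (evalMat s Φ *ᵥ WithLp.ofLp v) : EuclideanSpace ℂ ι)‖ := by
  by_contra! hlt
  have hv : 0 < ‖v‖ := by
    rcases (norm_nonneg v).eq_or_lt with h0 | h0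
    · rw [norm_eq_zero.1 h0.symm] at hlt; simp at hlt
    · exact h0
  obtain ⟨r, hr1, hr2⟩ := exists_between hlt
  have hcont : Continuous fun s : X ↦
      ‖(WithLp.toLp 2 (evalMat s Φ *ᵥ WithLp.ofLp v) : EuclideanSpace ℂ ι)‖ :=
    ((continuous_evalMat_mulVec Φ).comp (Continuous.prodMk_left v)).norm
  obtain ⟨W, hsW, hWo, hWfin⟩ := ν.exists_isOpen_measure_lt_top s
  let U := W ∩ {s | ‖(WithLp.toLp 2 (evalMat s Φ *ᵥ WithLp.ofLp v) : EuclideanSpace ℂ ι)‖ < r}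
  have hUo : IsOpen U := hWo.inter (isOpen_lt hcont continuous_const)
  have hUpos : 0 < ν U := hUo.measure_pos ν ⟨s, hsW, hr1⟩
  have hUfin : ν U ≠ ∞ := ((measure_mono Set.inter_subset_left).trans_lt hWfin).ne
  have hr0 : 0 ≤ r := (norm_nonneg _).trans hr1.le
  let g : Lp (EuclideanSpace ℂ ι) 2 ν := indicatorConstLp 2 hUo.measurableSet hUfin v
  have hg : 0 < ‖g‖ := by
    rw [norm_indicatorConstLp (by norm_num) (by norm_num)]
    exact mul_pos hv (Real.rpow_pos_of_pos (ENNReal.toReal_pos hUpos.ne' hUfin) _)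
  have hle : ‖mulOp ν Φ g‖ ≤ r / ‖v‖ * ‖g‖ := by
    refine Lp.norm_le_mul_norm_of_ae_le_mul ?_
    filter_upwards [coeFn_mulOp Φ g, indicatorConstLp_coeFn (p := 2) (hs := hUo.measurableSet)
      (hμs := hUfin) (c := v)] with t h1 h2
    rw [h1, h2]
    by_cases ht : t ∈ U
    · rw [Set.indicator_of_mem ht, div_mul_cancel₀ _ hv.ne']
      exact ht.2.le
    · rw [Set.indicator_of_notMem ht]; simp
  have h1 := (h g).trans hle
  have h2 : c ≤ r / ‖v‖ := le_of_mul_le_mul_right h1 hg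
  rw [le_div_iff₀ hv] at h2
  linarith

theorem subset_spectrum_mulOp [Nonempty X] [ν.IsOpenPosMeasure] [IsLocallyFiniteMeasure ν]
    (Φ : Matrix ι ι (X →ᵇ ℂ)) :
    {z | ⨅ s : X, ‖(z • (1 : Matrix ι ι ℂ) - evalMat s Φ).det‖ = 0} ⊆
      spectrum ℂ (mulOp ν Φ) := by
  intro z hz hres
  have hres' : IsUnit (mulOp ν (algebraMap ℂ _ z - Φ)) := by
    rw [mulOp_algebraMap_sub]; exact hres
  obtain ⟨T, hT⟩ := hres'
  set S : Lp (EuclideanSpace ℂ ι) 2 ν →L[ℂ] Lp (EuclideanSpace ℂ ι) 2 ν := ↑T⁻¹ with hS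
  -- Adding `1` keeps the constant positive even if `S = 0`.
  have hbound : ∀ g, (‖S‖ + 1)⁻¹ * ‖g‖ ≤
      ‖mulOp ν (algebraMap ℂ _ z - Φ) g‖ := fun g ↦ by
    have h1 : S (mulOp ν (algebraMap ℂ _ z - Φ) g) = g := by
      rw [← hT]; exact DFunLike.congr_fun T.inv_mul g
    have h2 := S.le_opNorm (mulOp ν (algebraMap ℂ _ z - Φ) g)
    rw [h1] at h2
    rw [inv_mul_le_iff₀ (by positivity)]
    nlinarith [norm_nonneg (mulOp ν (algebraMap ℂ _ z - Φ) g)]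
  have hdet := fun s : X ↦ norm_det_ge_of_bound (by positivity) (evalMat_bounded_below hbound s)
  simp only [evalMat_algebraMap_sub] at hdet
  have := le_ciInf hdet
  rw [Set.mem_ofPred_eq] at hz
  rw [hz] at this
  exact absurd this (not_le.2 (by positivity))

theorem spectrum_mulOp [Nonempty X] [ν.IsOpenPosMeasure] [IsLocallyFiniteMeasure ν]
    (Φ : Matrix ι ι (X →ᵇ ℂ)) :
    spectrum ℂ (mulOp ν Φ) =
      {z | ⨅ s : X, ‖(z • (1 : Matrix ι ι ℂ) - evalMat s Φ).det‖ = 0} :=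
  ((AlgHom.spectrum_apply_subset (mulOpHom ν) Φ).trans
    (spectrum_matrix_subset Φ)).antisymm (subset_spectrum_mulOp Φ)

variable (ν) in
theorem spectrum_mulOp_eq_spectrum [Nonempty X] [ν.IsOpenPosMeasure] [IsLocallyFiniteMeasure ν]
    (Φ : Matrix ι ι (X →ᵇ ℂ)) : spectrum ℂ (mulOp ν Φ) = spectrum ℂ Φ :=
  (AlgHom.spectrum_apply_subset (mulOpHom ν) Φ).antisymm
    ((spectrum_matrix_subset Φ).trans (subset_spectrum_mulOp Φ))

/-- Cancels `Φ` on `E` although `Φ` may be singular at every point there: each column of `Ψ`, cut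
off to a part of `E` of finite measure, is an `L²` function killed by `Φ`. -/
theorem ae_evalMat_eq_zero_of_mulOp_injective [SigmaFinite ν] {Φ Ψ : Matrix ι ι (X →ᵇ ℂ)}
    {E : Set X} (hE : MeasurableSet E) (hΦ : ∀ g, mulOp ν Φ g = 0 → g = 0)
    (h : ∀ᵐ s ∂ν, s ∈ E → evalMat s (Φ * Ψ) = 0) : ∀ᵐ s ∂ν, s ∈ E → evalMat s Ψ = 0 := by
  have key : ∀ (j : ι) (k : ℕ), ∀ᵐ s ∂ν, s ∈ E ∩ spanningSets ν k →
      evalMat s Ψ *ᵥ Pi.single j 1 = 0 := fun j k ↦ by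
    have hm : MeasurableSet (E ∩ spanningSets ν k) := hE.inter (measurableSet_spanningSets ν k)
    have hfin : ν (E ∩ spanningSets ν k) ≠ ∞ :=
      ((measure_mono Set.inter_subset_right).trans_lt (measure_spanningSets_lt_top ν k)).ne
    let g : Lp (EuclideanSpace ℂ ι) 2 ν := indicatorConstLp 2 hm hfin (EuclideanSpace.single j 1)
    have hg : g =ᵐ[ν] _ := indicatorConstLp_coeFn
    have h0 : mulOp ν (Φ * Ψ) g = 0 := by
      apply Lp.ext
      filter_upwards [coeFn_mulOp (Φ * Ψ) g, hg, h, Lp.coeFn_zero (EuclideanSpace ℂ ι) 2 ν]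
        with s h1 h2 h3 h4
      rw [h1, h2, h4]
      by_cases hs : s ∈ E ∩ spanningSets ν k
      · rw [h3 hs.1]; simp
      · rw [Set.indicator_of_notMem hs]; simp
    rw [mulOp_mul] at h0
    have h1 : mulOp ν Ψ g = 0 := hΦ _ h0
    filter_upwards [coeFn_mulOp Ψ g, hg, (Lp.eq_zero_iff_ae_eq_zero).1 h1] with s h2 h3 h4 hs
    rw [h4, h3, Set.indicator_of_mem hs] at h2
    exact (congrArg WithLp.ofLp h2).symm
  filter_upwards [ae_all_iff.2 fun j ↦ ae_all_iff.2 (key j)] with s hs hsE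
  obtain ⟨k, hk⟩ : ∃ k, s ∈ spanningSets ν k :=
    ⟨_, mem_spanningSetsIndex ν s⟩
  ext i j
  simpa using congrFun (hs j k ⟨hsE, hk⟩) i

-- Cayley–Hamilton gives a polynomial relation for `Φ`. On the singular set its constant coefficient
-- vanishes, so a factor `Φ` splits off and injectivity cancels it. Repeating this lowers the
-- characteristic polynomial to `1`, whence `1 = 0` almost everywhere on that set.
open Polynomial in
theorem measure_det_eq_zero_of_mulOp_injective [Nonempty ι] [SigmaFinite ν]
    {Φ : Matrix ι ι (X →ᵇ ℂ)} (hΦ : ∀ g, mulOp ν Φ g = 0 → g = 0) :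
    ν {s | (evalMat s Φ).det = 0} = 0 := by
  have key : ∀ k : ℕ, ∀ᵐ s ∂ν, s ∈ {s | (evalMat s Φ).det = 0} →
      evalMat s (aeval Φ (divX^[k] Φ.charpoly)) = 0 := fun k ↦ by
    induction k with
    | zero => simp [Matrix.aeval_self_charpoly]
    | succ k ih =>
      set q := divX^[k] Φ.charpoly with hq
      rw [Function.iterate_succ_apply', ← hq]
      have hdecomp : aeval Φ q = Φ * aeval Φ q.divX + algebraMap _ _ (q.coeff 0) := by
        conv_lhs => rw [← X_mul_divX_add q]
        rw [map_add, map_mul, aeval_X, aeval_C]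
      refine ae_evalMat_eq_zero_of_mulOp_injective (isClosed_det_eq_zero Φ).measurableSet hΦ ?_
      filter_upwards [ih] with s hs hsE
      have h1 := hs hsE
      have hc : evalMat s (algebraMap (X →ᵇ ℂ) (Matrix ι ι (X →ᵇ ℂ)) (q.coeff 0)) =
          Matrix.scalar ι (q.coeff 0 s) := by
        ext i j
        by_cases h : i = j
        · subst h; simp [Matrix.algebraMap_matrix_apply]
        · simp [Matrix.algebraMap_matrix_apply, h]
      rw [hdecomp, map_add, hc] at h1
      -- `Φ s` is singular on this set, so the product has determinant zero; hence so has the scalar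
      -- matrix, and the scalar itself is zero.
      have h2 := congrArg Matrix.det (eq_neg_of_add_eq_zero_left h1)
      rw [map_mul, Matrix.det_mul, show (evalMat s Φ).det = 0 from hsE, zero_mul, ← map_neg] at h2
      have h3 : q.coeff 0 s = 0 := by
        rw [Matrix.scalar_apply, Matrix.det_diagonal, Finset.prod_const, eq_comm] at h2
        simpa using eq_zero_of_pow_eq_zero h2
      rw [h3, map_zero, add_zero] at h1
      exact h1
  have hcoeff : ∀ (p : (X →ᵇ ℂ)[X]) (k i : ℕ), (divX^[k] p).coeff i = p.coeff (i + k) := by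
    intro p k
    induction k with
    | zero => simp
    | succ k ih => intro i; rw [Function.iterate_succ_apply', coeff_divX, ih]; congr 1; ring
  -- The characteristic polynomial is monic of degree `card ι`, so only its leading coefficient
  -- survives.
  have hone : (divX^[Fintype.card ι] Φ.charpoly) = 1 := by
    nontriviality (X →ᵇ ℂ)
    ext1 i
    rw [hcoeff]
    rcases Nat.eq_zero_or_pos i with rfl | hi
    · rw [zero_add, coeff_one_zero, ← Φ.charpoly_natDegree_eq_dim]
      exact Φ.charpoly_monic
    · rw [coeff_eq_zero_of_natDegree_lt (by rw [Φ.charpoly_natDegree_eq_dim]; omega), coeff_one,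
        if_neg hi.ne']
  have := key (Fintype.card ι)
  rw [hone] at this
  simp only [map_one, one_ne_zero, imp_false] at this
  exact measure_eq_zero_iff_ae_notMem.2 this

theorem mulOp_eq_zero_imp {Φ : Matrix ι ι (X →ᵇ ℂ)}
    (h : ν {s | (evalMat s Φ).det = 0} = 0) (g : Lp (EuclideanSpace ℂ ι) 2 ν)
    (hg : mulOp ν Φ g = 0) : g = 0 := by
  rw [Lp.eq_zero_iff_ae_eq_zero] at hg ⊢
  filter_upwards [coeFn_mulOp Φ g, hg, measure_eq_zero_iff_ae_notMem.1 h] with s h1 h2 h3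
  rw [h2] at h1
  have := Matrix.eq_zero_of_mulVec_eq_zero h3 (congrArg WithLp.ofLp h1).symm
  simpa using this

theorem pointSpectrum_mulOp [Nonempty ι] [SigmaFinite ν] (Φ : Matrix ι ι (X →ᵇ ℂ)) :
    pointSpectrum (mulOp ν Φ) =
      {z | 0 < ν {s | (z • (1 : Matrix ι ι ℂ) - evalMat s Φ).det = 0}} := by
  ext z
  have hsub : ∀ g, mulOp ν (algebraMap ℂ _ z - Φ) g = z • g - mulOp ν Φ g := fun g ↦ by
    rw [mulOp_algebraMap_sub]; rfl
  simp only [← evalMat_algebraMap_sub]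
  rw [Set.mem_ofPred_eq]
  refine ⟨fun ⟨g, hg0, hg⟩ ↦ pos_iff_ne_zero.2 fun h ↦ hg0 ?_, fun h ↦ ?_⟩
  · exact mulOp_eq_zero_imp h g (by rw [hsub, hg, sub_self])
  · by_contra hz
    refine h.ne' (measure_det_eq_zero_of_mulOp_injective fun g hg ↦ ?_)
    by_contra hg0
    rw [hsub, sub_eq_zero] at hg
    exact hz ⟨g, hg0, hg.symm⟩

/-- For a normal operator the orthogonal complement of the range is the kernel, so injectivity
forces dense range. -/
theorem residualSpectrum_eq_empty {Y : Type*} [NormedAddCommGroup Y] [InnerProductSpace ℂ Y]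
    [CompleteSpace Y] {T : Y →L[ℂ] Y} (hT : IsStarNormal T) : residualSpectrum T = ∅ := by
  refine Set.eq_empty_of_forall_notMem fun z ⟨_, hinj, hdense⟩ ↦ hdense ?_
  have hS : IsStarNormal (algebraMap ℂ (Y →L[ℂ] Y) z - T) := by
    refine ⟨?_⟩
    rw [star_sub]
    refine Commute.sub_left ?_ ?_
    · rw [← algebraMap_star_comm]
      exact Algebra.commutes _ _
    · exact Commute.sub_right (Algebra.commutes _ _).symm hT.star_comm_self
  have hS' : (algebraMap ℂ (Y →L[ℂ] Y) z - T).rangeᗮ = ⊥ := by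
    rw [ContinuousLinearMap.IsStarNormal.orthogonal_range hS]
    exact LinearMap.ker_eq_bot.2 hinj
  have := (Submodule.topologicalClosure_eq_top_iff).2 hS'
  exact Submodule.dense_iff_topologicalClosure_eq_top.2 this

end Spectrum

/-! ### Linear changes of variables. -/

section ActVolume

open scoped ENNReal

variable {n : ℕ}

theorem act_eq_toEuclideanLin (B : Matrix (Fin n) (Fin n) ℝ) :
    act B = Matrix.toEuclideanLin B := rfl

theorem act_act (B C : Matrix (Fin n) (Fin n) ℝ) (x : E n) : act B (act C x) = act (B * C) x := by
  simp [act, Matrix.mulVec_mulVec]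

theorem act_one (x : E n) : act 1 x = x := by simp [act]

theorem continuous_act (B : Matrix (Fin n) (Fin n) ℝ) : Continuous (act B) := by
  rw [act_eq_toEuclideanLin]; exact LinearMap.continuous_of_finiteDimensional _

theorem map_act_volume {B : Matrix (Fin n) (Fin n) ℝ} (hB : B.det ≠ 0) :
    Measure.map (act B) (volume : Measure (E n)) = ENNReal.ofReal |B.det|⁻¹ • volume := by
  have hdet : LinearMap.det (Matrix.toEuclideanLin B) = B.det := by
    rw [Matrix.toEuclideanLin, Matrix.toLpLin_eq_toLin, LinearMap.det_toLin]
  rw [act_eq_toEuclideanLin, Measure.map_linearMap_addHaar_eq_smul_addHaar _ (by rwa [hdet]), hdet,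
    abs_inv]

theorem abs_det_orthogonal {C : Matrix (Fin n) (Fin n) ℝ} (hC : C ∈ Matrix.orthogonalGroup (Fin n) ℝ) :
    |C.det| = 1 := by
  have h := congrArg Matrix.det ((Matrix.mem_orthogonalGroup_iff' (Fin n) ℝ).1 hC)
  rw [Matrix.det_mul, Matrix.det_one] at h
  have h2 : C.det * C.det = 1 := by simpa [Matrix.star_eq_conjTranspose] using h
  rcases mul_self_eq_one_iff.1 h2 with h | h <;> simp [h]

theorem measurePreserving_act {C : Matrix (Fin n) (Fin n) ℝ}
    (hC : C ∈ Matrix.orthogonalGroup (Fin n) ℝ) :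
    MeasurePreserving (act C) (volume : Measure (E n)) volume := by
  have h1 := abs_det_orthogonal hC
  refine ⟨(continuous_act C).measurable, ?_⟩
  rw [map_act_volume (fun h ↦ by simp [h] at h1), h1]
  simp

theorem lintegral_comp_act {B : Matrix (Fin n) (Fin n) ℝ} (hB : B.det ≠ 0) {h : E n → ℝ≥0∞}
    (hh : Measurable h) : ∫⁻ x, h (act B x) = ENNReal.ofReal |B.det|⁻¹ * ∫⁻ x, h x := by
  rw [← lintegral_map hh (continuous_act B).measurable, map_act_volume hB, lintegral_smul_measure,
    smul_eq_mul]

end ActVolume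

/-! ### Logarithmic coordinates on the hyperoctants. -/

section HyperoctantCoordinates

open scoped ENNReal

variable {n : ℕ}

/-- Logarithmic coordinates on the hyperoctant with sign vector `σ`. -/
noncomputable def expMap (σ : Fin n → ℤˣ) (t : E n) : E n :=
  WithLp.toLp 2 fun k ↦ ((σ k : ℤ) : ℝ) * Real.exp (2 * Real.pi * t k)

/-- The inverse of the logarithmic coordinates. -/
noncomputable def logMap (x : Fin n → ℝ) : E n :=
  WithLp.toLp 2 fun k ↦ Real.log |x k| / (2 * Real.pi)

/-- The square root of the Jacobian of the logarithmic coordinates. -/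
noncomputable def weight (t : E n) : ℝ :=
  (2 * Real.pi) ^ ((n : ℝ) / 2) * Real.exp (Real.pi * ∑ k, t k)

theorem weight_pos (t : E n) : 0 < weight t := by unfold weight; positivity

theorem continuous_weight : Continuous (weight : E n → ℝ) := by unfold weight; fun_prop

theorem continuous_expMap (σ : Fin n → ℤˣ) : Continuous (expMap σ) := by
  unfold expMap; fun_prop

@[simp] theorem expMap_apply (σ : Fin n → ℤˣ) (t : E n) (k : Fin n) :
    expMap σ t k = ((σ k : ℤ) : ℝ) * Real.exp (2 * Real.pi * t k) := rfl

theorem abs_units_int (ε : ℤˣ) : |((ε : ℤ) : ℝ)| = 1 := by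
  rcases Int.units_eq_one_or ε with h | h <;> simp [h]

theorem sign_units_int_mul (ε : ℤˣ) {r : ℝ} (hr : 0 < r) :
    Real.sign (((ε : ℤ) : ℝ) * r) = ((ε : ℤ) : ℝ) := by
  rcases Int.units_eq_one_or ε with h | h
  · simp [h, Real.sign_of_pos hr]
  · simp [h, Real.sign_of_neg (neg_neg_of_pos hr)]

theorem units_int_mul_abs_of_sign {x : ℝ} {ε : ℤˣ} (h : Real.sign x = ((ε : ℤ) : ℝ)) :
    ((ε : ℤ) : ℝ) * |x| = x ∧ x ≠ 0 := by
  rcases Int.units_eq_one_or ε with rfl | rfl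
  · rcases lt_trichotomy x 0 with hx | rfl | hx
    · rw [Real.sign_of_neg hx] at h; norm_num at h
    · simp at h
    · simp [abs_of_pos hx, hx.ne']
  · rcases lt_trichotomy x 0 with hx | rfl | hx
    · simp [abs_of_neg hx, hx.ne]
    · simp at h
    · rw [Real.sign_of_pos hx] at h; norm_num at h

theorem logMap_expMap (σ : Fin n → ℤˣ) (t : E n) : logMap (expMap σ t) = t := by
  ext k
  simp only [logMap, expMap_apply, abs_mul, abs_units_int, one_mul, Real.abs_exp, Real.log_exp]
  field_simp

theorem expMap_mem (σ : Fin n → ℤˣ) (t : E n) : expMap σ t ∈ hyperoctant σ :=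
  fun k ↦ sign_units_int_mul (σ k) (Real.exp_pos _)

theorem expMap_logMap {σ : Fin n → ℤˣ} {x : E n} (hx : x ∈ hyperoctant σ) :
    expMap σ (logMap x) = x := by
  ext k
  obtain ⟨h1, h2⟩ := units_int_mul_abs_of_sign (hx k)
  have h3 : 2 * Real.pi * (logMap x) k = Real.log |x k| := by
    change 2 * Real.pi * (Real.log |x k| / (2 * Real.pi)) = _
    field_simp
  rw [expMap_apply, h3, Real.exp_log (abs_pos.2 h2), h1]

theorem image_expMap (σ : Fin n → ℤˣ) : expMap σ '' Set.univ = hyperoctant σ := by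
  ext x
  exact ⟨by rintro ⟨t, -, rfl⟩; exact expMap_mem σ t, fun h ↦ ⟨_, trivial, expMap_logMap h⟩⟩

theorem injective_expMap (σ : Fin n → ℤˣ) : Function.Injective (expMap σ) :=
  Function.LeftInverse.injective (g := fun x : E n ↦ logMap x) (logMap_expMap σ)

/-- The derivative of `expMap`. -/
noncomputable def expMapDeriv (σ : Fin n → ℤˣ) (t : E n) : E n →L[ℝ] E n :=
  LinearMap.toContinuousLinearMap (Matrix.toEuclideanLin
    (Matrix.diagonal fun k ↦ ((σ k : ℤ) : ℝ) * (Real.exp (2 * Real.pi * t k) * (2 * Real.pi))))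

theorem hasFDerivAt_expMap (σ : Fin n → ℤˣ) (t : E n) :
    HasFDerivAt (expMap σ) (expMapDeriv σ t) t := by
  rw [← hasFDerivWithinAt_univ, hasFDerivWithinAt_piLp]
  intro k
  rw [hasFDerivWithinAt_univ]
  have h1 : HasFDerivAt (fun t : E n ↦ t k) (EuclideanSpace.proj k : E n →L[ℝ] ℝ) t :=
    (EuclideanSpace.proj k : E n →L[ℝ] ℝ).hasFDerivAt
  have h2 := ((h1.const_mul (2 * Real.pi)).exp).const_mul (((σ k : ℤ) : ℝ))
  refine h2.congr_fderiv ?_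
  ext v
  simp [expMapDeriv, Matrix.mulVec_diagonal]
  ring

theorem abs_det_expMapDeriv (σ : Fin n → ℤˣ) (t : E n) :
    |(expMapDeriv σ t).det| = weight t ^ 2 := by
  have h1 : (expMapDeriv σ t).det =
      ∏ k, ((σ k : ℤ) : ℝ) * (Real.exp (2 * Real.pi * t k) * (2 * Real.pi)) := by
    rw [expMapDeriv, ContinuousLinearMap.det, LinearMap.coe_toContinuousLinearMap,
      Matrix.toEuclideanLin, Matrix.toLpLin_eq_toLin, LinearMap.det_toLin, Matrix.det_diagonal]
  rw [h1, Finset.abs_prod]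
  simp only [abs_mul, abs_units_int, one_mul, Real.abs_exp]
  rw [Finset.prod_mul_distrib, ← Real.exp_sum, weight, mul_pow, ← Real.rpow_natCast,
    ← Real.rpow_mul (by positivity), ← Real.exp_nat_mul, ← Finset.mul_sum]
  simp only [abs_of_pos Real.pi_pos, abs_two, Finset.prod_const, Finset.card_univ, Fintype.card_fin]
  rw [mul_comm]
  congr 1
  · rw [← Real.rpow_natCast]; congr 1; push_cast; ring
  · congr 1; push_cast; ring

theorem lintegral_hyperoctant (σ : Fin n → ℤˣ) (h : E n → ℝ≥0∞) :
    ∫⁻ x in hyperoctant σ, h x = ∫⁻ t, ENNReal.ofReal (weight t ^ 2) * h (expMap σ t) := by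
  rw [← image_expMap, lintegral_image_eq_lintegral_abs_det_fderiv_mul volume MeasurableSet.univ
    (fun t _ ↦ (hasFDerivAt_expMap σ t).hasFDerivWithinAt) (injective_expMap σ).injOn]
  simp only [abs_det_expMapDeriv, Measure.restrict_univ]

theorem integral_hyperoctant {F : Type*} [NormedAddCommGroup F] [NormedSpace ℝ F]
    (σ : Fin n → ℤˣ) (h : E n → F) :
    ∫ x in hyperoctant σ, h x = ∫ t, weight t ^ 2 • h (expMap σ t) := by
  rw [← image_expMap, integral_image_eq_integral_abs_det_fderiv_smul volume MeasurableSet.univ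
    (fun t _ ↦ (hasFDerivAt_expMap σ t).hasFDerivWithinAt) (injective_expMap σ).injOn]
  simp only [abs_det_expMapDeriv, Measure.restrict_univ]

theorem integrableOn_hyperoctant {F : Type*} [NormedAddCommGroup F] [NormedSpace ℝ F]
    (σ : Fin n → ℤˣ) (h : E n → F) :
    IntegrableOn h (hyperoctant σ) ↔ Integrable fun t ↦ weight t ^ 2 • h (expMap σ t) := by
  rw [← image_expMap, integrableOn_image_iff_integrableOn_abs_det_fderiv_smul volume
    MeasurableSet.univ (fun t _ ↦ (hasFDerivAt_expMap σ t).hasFDerivWithinAt)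
    (injective_expMap σ).injOn]
  simp only [abs_det_expMapDeriv, integrableOn_univ]

theorem measurableSet_hyperoctant (σ : Fin n → ℤˣ) : MeasurableSet (hyperoctant σ : Set (E n)) := by
  rw [← image_expMap]
  exact measurable_image_of_fderivWithin MeasurableSet.univ
    (fun t _ ↦ (hasFDerivAt_expMap σ t).hasFDerivWithinAt) (injective_expMap σ).injOn

theorem disjoint_hyperoctant {σ τ : Fin n → ℤˣ} (h : σ ≠ τ) :
    Disjoint (hyperoctant σ) (hyperoctant τ) := by
  refine Set.disjoint_left.2 fun x hx hx' ↦ h ?_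
  ext k
  exact_mod_cast (hx k).symm.trans (hx' k)

theorem ae_mem_hyperoctant : ∀ᵐ x : E n, ∃ σ : Fin n → ℤˣ, x ∈ hyperoctant σ := by
  have h1 : ∀ k : Fin n, ∀ᵐ x : E n, x k ≠ 0 := fun k ↦ by
    have h := Measure.addHaar_submodule (volume : Measure (E n))
      (EuclideanSpace.proj k : E n →L[ℝ] ℝ).ker (fun htop ↦ by
        have : (EuclideanSpace.single k (1 : ℝ)) ∈ (EuclideanSpace.proj k : E n →L[ℝ] ℝ).ker := by
          rw [htop]; trivial
        simp at this)
    exact measure_eq_zero_iff_ae_notMem.1 h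
  filter_upwards [ae_all_iff.2 h1] with x hx
  refine ⟨fun k ↦ if 0 < x k then 1 else -1, fun k ↦ ?_⟩
  by_cases h : 0 < x k
  · simp [h, Real.sign_of_pos h]
  · simp [h, Real.sign_of_neg (lt_of_le_of_ne (not_lt.1 h) (hx k))]

theorem lintegral_eq_sum_hyperoctant {ι : Type*} [Fintype ι] (e : ι ≃ (Fin n → ℤˣ))
    (h : E n → ℝ≥0∞) :
    ∫⁻ x, h x = ∑ i, ∫⁻ t, ENNReal.ofReal (weight t ^ 2) * h (expMap (e i) t) := by
  simp only [← lintegral_hyperoctant]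
  rw [← tsum_fintype (L := .unconditional _), ← lintegral_iUnion
    (fun i ↦ measurableSet_hyperoctant (e i))
    (fun i j hij ↦ disjoint_hyperoctant (e.injective.ne hij))]
  have : (⋃ i, hyperoctant (e i) : Set (E n)) =ᵐ[volume] Set.univ := by
    rw [Filter.eventuallyEq_univ]
    filter_upwards [ae_mem_hyperoctant] with x ⟨σ, hσ⟩
    exact Set.mem_iUnion.2 ⟨e.symm σ, by simpa using hσ⟩
  rw [Measure.restrict_congr_set this, Measure.restrict_univ]

/-- The Jacobian never vanishes. This is what lets `logCoord` act on almost-everywhere classes. -/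
theorem quasiMeasurePreserving_expMap (σ : Fin n → ℤˣ) :
    Measure.QuasiMeasurePreserving (expMap σ) (volume : Measure (E n)) volume := by
  refine ⟨(continuous_expMap σ).measurable, Measure.AbsolutelyContinuous.mk fun s hs h0 ↦ ?_⟩
  rw [Measure.map_apply (continuous_expMap σ).measurable hs]
  have h1 : ∫⁻ x in hyperoctant σ, s.indicator 1 x = 0 := by
    refine le_antisymm ((setLIntegral_le_lintegral _ _).trans ?_) zero_le
    rw [lintegral_indicator_one hs, h0]
  rw [lintegral_hyperoctant, lintegral_eq_zero_iff] at h1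
  · refine measure_eq_zero_iff_ae_notMem.2 ?_
    filter_upwards [h1] with t ht hmem
    have : s.indicator (1 : E n → ℝ≥0∞) (expMap σ t) = 1 := by
      rw [Set.indicator_of_mem (show expMap σ t ∈ s from hmem)]; rfl
    simp only [this, mul_one, Pi.zero_apply, ENNReal.ofReal_eq_zero] at ht
    exact absurd ht (not_le.2 (pow_pos (weight_pos t) 2))
  · exact ((continuous_weight.pow 2).measurable.ennreal_ofReal).mul
      ((measurable_one.indicator hs).comp (continuous_expMap σ).measurable)

end HyperoctantCoordinates

/-! ### The hyperoctant-wise Mellin transform as a unitary operator. -/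

section LogTransform

open scoped ENNReal

variable {n : ℕ} {C : Matrix (Fin n) (Fin n) ℝ} (e : Fin (2 ^ n) ≃ (Fin n → ℤˣ))

/-- A function on `ℝⁿ`, in the coordinates given by `C` and the logarithmic coordinates of the
hyperoctants, normalized by the square root of the Jacobian. -/
noncomputable def logCoord (C : Matrix (Fin n) (Fin n) ℝ) (f : E n → ℂ) (t : E n) : CVec n :=
  WithLp.toLp 2 fun i ↦ (weight t : ℂ) * f (act C (expMap (e i) t))

theorem logCoord_apply (f : E n → ℂ) (t : E n) (i : Fin (2 ^ n)) :
    logCoord e C f t i = (weight t : ℂ) * f (act C (expMap (e i) t)) := rfl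

theorem enorm_sq_eq_sum {ι : Type*} [Fintype ι] (v : EuclideanSpace ℂ ι) :
    ‖v‖ₑ ^ 2 = ∑ i, ‖v i‖ₑ ^ 2 := by
  simp only [← ofReal_norm]
  simp only [← ENNReal.ofReal_pow (norm_nonneg _)]
  rw [EuclideanSpace.norm_sq_eq, ENNReal.ofReal_sum_of_nonneg fun i _ ↦ by positivity]

theorem logCoord_congr_ae (hC : C ∈ Matrix.orthogonalGroup (Fin n) ℝ) {f g : E n → ℂ}
    (h : f =ᵐ[volume] g) : logCoord e C f =ᵐ[volume] logCoord e C g := by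
  have h1 := fun i ↦ ((measurePreserving_act hC).quasiMeasurePreserving.comp
    (quasiMeasurePreserving_expMap (e i))).ae_eq_comp h
  filter_upwards [ae_all_iff.2 h1] with t ht
  ext i
  have := ht i
  simp only [Function.comp_apply] at this
  rw [logCoord_apply, logCoord_apply, this]

theorem stronglyMeasurable_logCoord {f : E n → ℂ} (hf : StronglyMeasurable f) :
    StronglyMeasurable (logCoord e C f) := by
  refine (PiLp.continuous_toLp 2 _).comp_stronglyMeasurable
    (measurable_pi_lambda _ fun i ↦ ?_).stronglyMeasurable
  exact (Complex.continuous_ofReal.comp continuous_weight).measurable.mul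
    (hf.measurable.comp ((continuous_act C).comp (continuous_expMap _)).measurable)

/-- The square of `weight` is the Jacobian on each hyperoctant, the hyperoctants cover almost
everything, and `C` preserves volume. -/
theorem lintegral_logCoord (hC : C ∈ Matrix.orthogonalGroup (Fin n) ℝ) {f : E n → ℂ}
    (hf : StronglyMeasurable f) :
    ∫⁻ t, ‖logCoord e C f t‖ₑ ^ 2 = ∫⁻ x, ‖f x‖ₑ ^ 2 := by
  have h1 := lintegral_eq_sum_hyperoctant e fun x ↦ ‖f (act C x)‖ₑ ^ 2
  rw [(measurePreserving_act hC).lintegral_comp (f := fun x ↦ ‖f x‖ₑ ^ 2)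
    (hf.enorm.pow_const 2)] at h1
  rw [h1, ← lintegral_finsetSum]
  · refine lintegral_congr fun t ↦ ?_
    rw [enorm_sq_eq_sum]
    refine Finset.sum_congr rfl fun i _ ↦ ?_
    rw [logCoord_apply, enorm_mul, mul_pow, ENNReal.ofReal_pow (weight_pos t).le]
    congr 2
    rw [← ofReal_norm, Complex.norm_real, Real.norm_of_nonneg (weight_pos t).le]
  · intro i _
    exact (continuous_weight.pow 2).measurable.ennreal_ofReal.mul
      ((hf.enorm.pow_const 2).comp ((continuous_act C).comp (continuous_expMap _)).measurable)

theorem memLp_two_iff {X F : Type*} [MeasurableSpace X] [NormedAddCommGroup F] {ν : Measure X}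
    {f : X → F} (hf : AEStronglyMeasurable f ν) : MemLp f 2 ν ↔ ∫⁻ x, ‖f x‖ₑ ^ 2 ∂ν < ∞ := by
  rw [← eLpNorm_two_sq, ENNReal.pow_lt_top_iff]
  simp [MemLp, hf]

theorem memLp_logCoord (hC : C ∈ Matrix.orthogonalGroup (Fin n) ℝ) (f : L2 n) :
    MemLp (logCoord e C f) 2 := by
  have hf := Lp.stronglyMeasurable f
  rw [memLp_two_iff (stronglyMeasurable_logCoord e hf).aestronglyMeasurable,
    lintegral_logCoord e hC hf]
  exact (memLp_two_iff hf.aestronglyMeasurable).1 (Lp.memLp f)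

/-- `logCoord` as a linear isometry of `L²` spaces. -/
noncomputable def logIsometry (hC : C ∈ Matrix.orthogonalGroup (Fin n) ℝ) : L2 n →ₗᵢ[ℂ] L2Vec n where
  toFun f := (memLp_logCoord e hC f).toLp
  map_add' f g := by
    rw [← MemLp.toLp_add]
    refine MemLp.toLp_congr _ _ ?_
    filter_upwards [logCoord_congr_ae e hC (Lp.coeFn_add f g)] with t ht
    rw [ht]
    ext i
    simp [logCoord_apply, mul_add]
  map_smul' c f := by
    rw [RingHom.id_apply, ← MemLp.toLp_const_smul]
    refine MemLp.toLp_congr _ _ ?_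
    filter_upwards [logCoord_congr_ae e hC (Lp.coeFn_smul c f)] with t ht
    rw [ht]
    ext i
    simp only [logCoord_apply, Pi.smul_apply, PiLp.smul_apply, smul_eq_mul]
    ring
  norm_map' f := by
    rw [LinearMap.coe_mk, AddHom.coe_mk, Lp.norm_toLp, Lp.norm_def]
    congr 1
    refine (ENNReal.pow_right_strictMono two_ne_zero).injective ?_
    beta_reduce
    rw [eLpNorm_two_sq, eLpNorm_two_sq, lintegral_logCoord e hC (Lp.stronglyMeasurable f)]

theorem coeFn_logIsometry (hC : C ∈ Matrix.orthogonalGroup (Fin n) ℝ) (f : L2 n) :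
    logIsometry e hC f =ᵐ[volume] logCoord e C f :=
  (memLp_logCoord e hC f).coeFn_toLp

theorem act_transpose_act (hC : C ∈ Matrix.orthogonalGroup (Fin n) ℝ) (x : E n) :
    act Cᵀ (act C x) = x := by
  have h : Cᵀ * C = 1 := (Matrix.mem_orthogonalGroup_iff' (Fin n) ℝ).1 hC
  rw [act_act, h, act_one]

theorem measurable_logMap : Measurable fun x : E n ↦ logMap (n := n) x := by
  refine (PiLp.continuous_toLp 2 _).measurable.comp (measurable_pi_lambda _ fun k ↦ ?_)
  exact ((Real.measurable_log.comp
    (EuclideanSpace.proj k : E n →L[ℝ] ℝ).continuous.abs.measurable)).div_const _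

/-- The preimage is glued from the hyperoctants. Equality is pointwise, since `expMap` always lands
in the interior of its own hyperoctant. -/
theorem exists_logCoord_eq (hC : C ∈ Matrix.orthogonalGroup (Fin n) ℝ) {g : E n → CVec n}
    (hg : StronglyMeasurable g) : ∃ f : E n → ℂ, StronglyMeasurable f ∧ logCoord e C f = g := by
  let f' : E n → ℂ := fun x ↦ ∑ i, (hyperoctant (e i)).indicator
    (fun x ↦ ((weight (logMap x) : ℂ))⁻¹ * g (logMap x) i) x
  have hf' : StronglyMeasurable f' := by
    refine Finset.stronglyMeasurable_fun_sum _ fun i _ ↦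
      StronglyMeasurable.indicator ?_ (measurableSet_hyperoctant _)
    have h1 : Measurable fun x : E n ↦ ((weight (logMap x) : ℂ))⁻¹ :=
      ((Complex.continuous_ofReal.comp continuous_weight).measurable.comp
        measurable_logMap).inv
    have h2 : StronglyMeasurable fun x : E n ↦ g (logMap x) i :=
      (EuclideanSpace.proj i : CVec n →L[ℂ] ℂ).continuous.comp_stronglyMeasurable
        (hg.comp_measurable measurable_logMap)
    exact h1.stronglyMeasurable.mul h2
  refine ⟨fun y ↦ f' (act Cᵀ y), hf'.comp_measurable (continuous_act _).measurable, ?_⟩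
  ext t i
  rw [logCoord_apply, act_transpose_act hC]
  have h3 : f' (expMap (e i) t) = (weight t : ℂ)⁻¹ * g t i := by
    simp only [f']
    rw [Finset.sum_eq_single i]
    · rw [Set.indicator_of_mem (expMap_mem _ _), logMap_expMap]
    · intro j _ hj
      refine Set.indicator_of_notMem (fun h ↦ ?_) _
      exact Set.disjoint_left.1 (disjoint_hyperoctant (e.injective.ne hj)) h (expMap_mem _ _)
    · simp
  rw [h3, mul_inv_cancel_left₀]
  exact_mod_cast (weight_pos t).ne'

theorem surjective_logIsometry (hC : C ∈ Matrix.orthogonalGroup (Fin n) ℝ) :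
    Function.Surjective (logIsometry e hC) := by
  intro g
  obtain ⟨f, hf, hfg⟩ := exists_logCoord_eq e hC (Lp.stronglyMeasurable g)
  have hmem : MemLp f 2 := by
    rw [memLp_two_iff hf.aestronglyMeasurable, ← lintegral_logCoord e hC hf, hfg]
    exact (memLp_two_iff (Lp.aestronglyMeasurable g)).1 (Lp.memLp g)
  refine ⟨hmem.toLp, Lp.ext ?_⟩
  filter_upwards [coeFn_logIsometry e hC hmem.toLp, logCoord_congr_ae e hC hmem.coeFn_toLp]
    with t h1 h2
  rw [h1, h2, hfg]

open FourierTransform in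
/-- The hyperoctant-wise Mellin transform as a unitary operator. -/
noncomputable def mellinUnitary (hC : C ∈ Matrix.orthogonalGroup (Fin n) ℝ) : L2 n ≃ₗᵢ[ℂ] L2Vec n :=
  (LinearIsometryEquiv.ofSurjective (logIsometry e hC) (surjective_logIsometry e hC)).trans
    (Lp.fourierTransformₗᵢ (E n) (CVec n)).symm

open FourierTransform in
theorem mellinUnitary_apply (hC : C ∈ Matrix.orthogonalGroup (Fin n) ℝ) (f : L2 n) :
    mellinUnitary e hC f = (𝓕⁻ (logIsometry e hC f) : L2Vec n) := rfl

theorem absPow_expMap (σ : Fin n → ℤˣ) (t : E n) (z : Fin n → ℂ) :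
    absPow (expMap σ t) z = Complex.exp (∑ k, z k * (2 * Real.pi * t k : ℝ)) := by
  rw [absPow, Complex.exp_sum]
  refine Finset.prod_congr rfl fun k _ ↦ ?_
  rw [expMap_apply, abs_mul, abs_units_int, one_mul, Real.abs_exp, Real.log_exp]

/-- Jacobian times Mellin kernel is Fourier character times `weight`. The factor `2π` in `expMap`
matches the normalization of `Real.fourierChar`, and the constant cancels the one in `mellin`. -/
theorem weight_sq_mul_absPow (σ : Fin n → ℤˣ) (t s : E n) :
    ((weight t : ℂ)) ^ 2 * absPow (expMap σ t) (fun k ↦ -(1 / 2 : ℂ) + Complex.I * (s k : ℂ)) =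
      (((2 * Real.pi) ^ ((n : ℝ) / 2) : ℝ) : ℂ) *
        ((Real.fourierChar (inner ℝ t s) : Circle) : ℂ) * weight t := by
  have h1 : ∑ k, (-(1 / 2 : ℂ) + Complex.I * (s k : ℂ)) * ((2 * Real.pi * t k : ℝ) : ℂ) =
      -((Real.pi * ∑ k, t k : ℝ) : ℂ) + ((2 * Real.pi * inner ℝ t s : ℝ) : ℂ) * Complex.I := by
    rw [PiLp.inner_apply, Finset.mul_sum, Finset.mul_sum]
    push_cast
    rw [Finset.sum_mul, ← Finset.sum_neg_distrib, ← Finset.sum_add_distrib]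
    refine Finset.sum_congr rfl fun k _ ↦ ?_
    simp
    ring
  rw [absPow_expMap, h1, Complex.exp_add, Complex.exp_neg, ← Complex.ofReal_exp,
    Real.fourierChar_apply]
  have h2 : (weight t : ℂ) = (((2 * Real.pi) ^ ((n : ℝ) / 2) : ℝ) : ℂ) *
      ((Real.exp (Real.pi * ∑ k, t k) : ℝ) : ℂ) := by rw [weight]; push_cast; rfl
  have h3 : ((Real.exp (Real.pi * ∑ k, t k) : ℝ) : ℂ) ≠ 0 := by
    exact_mod_cast (Real.exp_pos _).ne'
  rw [h2]
  field_simp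

theorem weight_sq_mul_absPow_half (σ : Fin n → ℤˣ) (t : E n) :
    (weight t : ℂ) ^ 2 * absPow (expMap σ t) (fun _ ↦ -(1 / 2 : ℂ)) =
      (((2 * Real.pi) ^ ((n : ℝ) / 2) : ℝ) : ℂ) * weight t := by
  have := weight_sq_mul_absPow σ t 0
  simpa using this

-- Only the `i`-th component is known to be integrable, so it is projected out before the integral
-- formula for `𝓕⁻` is used.
open FourierTransform in
theorem isMellinTransform_mellinUnitary (hC : C ∈ Matrix.orthogonalGroup (Fin n) ℝ) :
    IsMellinTransform C e (mellinUnitary e hC) := by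
  intro f i hf
  have hc0 : (((2 * Real.pi) ^ ((n : ℝ) / 2) : ℝ) : ℂ) ≠ 0 := by
    exact_mod_cast (Real.rpow_pos_of_pos (by positivity) _).ne'
  have hint : Integrable fun t ↦ logCoord e C f t i := by
    rw [integrableOn_hyperoctant] at hf
    refine (hf.const_mul (((2 * Real.pi) ^ ((n : ℝ) / 2) : ℝ) : ℂ)⁻¹).congr
      (ae_of_all _ fun t ↦ ?_)
    simp only
    rw [Complex.real_smul, ← mul_assoc ((weight t ^ 2 : ℝ) : ℂ), Complex.ofReal_pow,
      weight_sq_mul_absPow_half, mul_assoc, inv_mul_cancel_left₀ hc0, logCoord_apply]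
  let P : CVec n →L[ℂ] ℂ := EuclideanSpace.proj i
  have hP : P.compLp (logIsometry e hC f) =ᵐ[volume] fun t ↦ logCoord e C f t i := by
    filter_upwards [P.coeFn_compLp (logIsometry e hC f), coeFn_logIsometry e hC f] with t h1 h2
    rw [h1, h2]; rfl
  have h1 := fourierInv_Lp_ae_eq (P.compLp (logIsometry e hC f)) (hint.congr hP.symm)
  rw [fourierInv_compLp] at h1
  filter_upwards [h1, P.coeFn_compLp (𝓕⁻ (logIsometry e hC f) : L2Vec n)] with s h2 h3
  rw [mellinUnitary_apply]
  refine (h3.symm.trans h2).trans ?_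
  rw [Real.fourierInv_congr_ae hP, Real.fourierInv_eq, mellin, integral_hyperoctant,
    ← integral_const_mul]
  refine integral_congr_ae (ae_of_all _ fun t ↦ ?_)
  simp only
  rw [Complex.real_smul, ← mul_assoc ((weight t ^ 2 : ℝ) : ℂ), Complex.ofReal_pow,
    weight_sq_mul_absPow, logCoord_apply, Circle.smul_def, smul_eq_mul, neg_div,
    Real.rpow_neg (by positivity), Complex.ofReal_inv]
  field_simp

end LogTransform

/-! ### Dilations under the Mellin transform. -/

section Dilations

variable {n : ℕ} (e : Fin (2 ^ n) ≃ (Fin n → ℤˣ))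

open Classical in
/-- The matrix by which the unitary dilation with the diagonal matrix `a` acts on the
hyperoctant-wise Mellin transforms. -/
noncomputable def dilMat (a : Fin n → ℝ) (s : E n) : Matrix (Fin (2 ^ n)) (Fin (2 ^ n)) ℂ :=
  Matrix.of fun i j ↦ if ∀ k, Real.sign (a k) = (((eps e i j k : ℤˣ) : ℤ) : ℝ) then
    Complex.exp (-(Complex.I * ∑ k, (s k : ℂ) * (Real.log |a k| : ℂ))) else 0

theorem exists_sign {a : Fin n → ℝ} (ha : ∀ k, a k ≠ 0) :
    ∃ τ : Fin n → ℤˣ, ∀ k, Real.sign (a k) = ((τ k : ℤ) : ℝ) := by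
  refine ⟨fun k ↦ if 0 < a k then 1 else -1, fun k ↦ ?_⟩
  by_cases h : 0 < a k
  · simp [h, Real.sign_of_pos h]
  · simp [h, Real.sign_of_neg (lt_of_le_of_ne (not_lt.1 h) (ha k))]

/-- Thus each row of `dilMat` has a single nonzero entry: a dilation carries each hyperoctant onto
exactly one other. -/
theorem sign_eq_eps_iff {a : Fin n → ℝ} {τ : Fin n → ℤˣ}
    (hτ : ∀ k, Real.sign (a k) = ((τ k : ℤ) : ℝ)) (i j : Fin (2 ^ n)) :
    (∀ k, Real.sign (a k) = (((eps e i j k : ℤˣ) : ℤ) : ℝ)) ↔ j = e.symm (τ * e i) := by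
  rw [Equiv.eq_symm_apply]
  constructor
  · intro h
    funext k
    have h1 : ((τ k : ℤ) : ℝ) = _ := (hτ k).symm.trans (h k)
    have h2 : τ k = eps e i j k := by exact_mod_cast h1
    rw [Pi.mul_apply, h2, eps, inv_mul_cancel_right]
  · intro h k
    rw [hτ, eps, h, Pi.mul_apply, mul_inv_cancel_right]

theorem dilMat_mulVec {a : Fin n → ℝ} {τ : Fin n → ℤˣ}
    (hτ : ∀ k, Real.sign (a k) = ((τ k : ℤ) : ℝ)) (s : E n) (v : Fin (2 ^ n) → ℂ)
    (i : Fin (2 ^ n)) :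
    (dilMat e a s *ᵥ v) i =
      Complex.exp (-(Complex.I * ∑ k, (s k : ℂ) * (Real.log |a k| : ℂ))) *
        v (e.symm (τ * e i)) := by
  simp only [Matrix.mulVec, dotProduct, dilMat, Matrix.of_apply, sign_eq_eps_iff e hτ, ite_mul,
    zero_mul, Finset.sum_ite_eq', Finset.mem_univ, if_true]

theorem act_diagonal_expMap {a : Fin n → ℝ} {τ : Fin n → ℤˣ}
    (hτ : ∀ k, Real.sign (a k) = ((τ k : ℤ) : ℝ)) (σ : Fin n → ℤˣ) (t : E n) :
    act (Matrix.diagonal a) (expMap σ t) = expMap (τ * σ) (t + logMap a) := by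
  ext k
  obtain ⟨h1, h2⟩ := units_int_mul_abs_of_sign (hτ k)
  simp only [act, expMap_apply, Matrix.mulVec_diagonal, PiLp.add_apply, logMap, Pi.mul_apply]
  rw [mul_add, mul_div_cancel₀ _ (by positivity), Real.exp_add, Real.exp_log (abs_pos.2 h2)]
  conv_lhs => rw [← h1]
  push_cast
  ring

/-- This factor absorbs `|det B|^{1/2}`, so a unitary dilation becomes a translation without a
scalar. -/
theorem weight_add_logMap {a : Fin n → ℝ} (ha : ∀ k, a k ≠ 0) (t : E n) :
    weight (t + logMap a) = weight t * √(∏ k, |a k|) := by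
  have h : √(∏ k, |a k|) = Real.exp (Real.pi * ∑ k, (logMap a) k) := by
    rw [Real.sqrt_eq_rpow, Real.rpow_def_of_pos (Finset.prod_pos fun k _ ↦ abs_pos.2 (ha k)),
      Real.log_prod fun k _ ↦ (abs_pos.2 (ha k)).ne']
    congr 1
    rw [Finset.sum_mul, Finset.mul_sum]
    refine Finset.sum_congr rfl fun k _ ↦ ?_
    simp only [logMap]
    field_simp
  rw [h, weight, weight, mul_assoc, ← Real.exp_add, ← mul_add, ← Finset.sum_add_distrib]
  rfl

variable {C B : Matrix (Fin n) (Fin n) ℝ} {a : Fin n → ℝ}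

theorem mul_orthogonal_eq (hC : C ∈ Matrix.orthogonalGroup (Fin n) ℝ)
    (h : Cᵀ * B * C = Matrix.diagonal a) : B * C = C * Matrix.diagonal a := by
  have h1 : C * Cᵀ = 1 := (Matrix.mem_orthogonalGroup_iff (Fin n) ℝ).1 hC
  rw [← h, ← mul_assoc, ← mul_assoc, h1, one_mul]

theorem det_eq_prod_of_diagonal (hC : C ∈ Matrix.orthogonalGroup (Fin n) ℝ)
    (h : Cᵀ * B * C = Matrix.diagonal a) : B.det = ∏ k, a k := by
  have h1 : Cᵀ * C = 1 := (Matrix.mem_orthogonalGroup_iff' (Fin n) ℝ).1 hC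
  have h2 := congrArg Matrix.det h1
  rw [Matrix.det_mul, Matrix.det_one] at h2
  have h3 := congrArg Matrix.det h
  rw [Matrix.det_mul, Matrix.det_mul, Matrix.det_diagonal] at h3
  rw [← h3, mul_right_comm, h2, one_mul]

theorem logCoord_dilation (hC : C ∈ Matrix.orthogonalGroup (Fin n) ℝ)
    (h : Cᵀ * B * C = Matrix.diagonal a) (hB : B.det ≠ 0) {τ : Fin n → ℤˣ}
    (hτ : ∀ k, Real.sign (a k) = ((τ k : ℤ) : ℝ)) (f : E n → ℂ) (t : E n) (i : Fin (2 ^ n)) :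
    logCoord e C (fun x ↦ (√|B.det| : ℂ) * f (act B x)) t i =
      logCoord e C f (t + logMap a) (e.symm (τ * e i)) := by
  have hdet := det_eq_prod_of_diagonal hC h
  have ha : ∀ k, a k ≠ 0 := fun k hk ↦
    hB (hdet.trans (Finset.prod_eq_zero (Finset.mem_univ k) hk))
  rw [logCoord_apply, logCoord_apply, act_act, mul_orthogonal_eq hC h, ← act_act,
    act_diagonal_expMap hτ, weight_add_logMap ha, hdet, Finset.abs_prod, Equiv.apply_symm_apply]
  push_cast
  ring

/-- In logarithmic coordinates the dilation is a permutation `P` of the components and a translation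
by `logMap a`. The inverse Fourier transform commutes with the former and turns the latter into a
phase. -/
theorem mellinUnitary_dilation (hC : C ∈ Matrix.orthogonalGroup (Fin n) ℝ)
    (h : Cᵀ * B * C = Matrix.diagonal a) (hB : B.det ≠ 0) (f g : L2 n)
    (hg : g =ᵐ[volume] fun x ↦ (√|B.det| : ℂ) * f (act B x)) :
    mellinUnitary e hC g =ᵐ[volume] fun s ↦
      WithLp.toLp 2 (dilMat e a s *ᵥ WithLp.ofLp (mellinUnitary e hC f s)) := by
  have ha : ∀ k, a k ≠ 0 := fun k hk ↦
    hB ((det_eq_prod_of_diagonal hC h).trans (Finset.prod_eq_zero (Finset.mem_univ k) hk))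
  obtain ⟨τ, hτ⟩ := exists_sign ha
  let P : CVec n →L[ℂ] CVec n := LinearMap.toContinuousLinearMap
    { toFun := fun v ↦ WithLp.toLp 2 fun i ↦ v (e.symm (τ * e i))
      map_add' := fun _ _ ↦ rfl
      map_smul' := fun _ _ ↦ rfl }
  have hP : ∀ v i, P v i = v (e.symm (τ * e i)) := fun _ _ ↦ rfl
  have htrans : logIsometry e hC g =ᵐ[volume]
      fun t ↦ P.compLp (logIsometry e hC f) (t + logMap a) := by
    have h1 : (fun t ↦ P.compLp (logIsometry e hC f) (t + logMap a)) =ᵐ[volume]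
        fun t ↦ P (logCoord e C f (t + logMap a)) := by
      have h2 : P.compLp (logIsometry e hC f) =ᵐ[volume] fun t ↦ P (logCoord e C f t) := by
        filter_upwards [P.coeFn_compLp (logIsometry e hC f), coeFn_logIsometry e hC f]
          with t h3 h4
        rw [h3, h4]
      exact (measurePreserving_add_right volume (logMap a)).quasiMeasurePreserving.ae_eq_comp h2
    filter_upwards [h1, coeFn_logIsometry e hC g, logCoord_congr_ae e hC hg] with t h2 h3 h4
    rw [h2, h3, h4]
    ext i
    rw [logCoord_dilation e hC h hB hτ, hP]
  have h5 := fourierInv_translate _ _ _ htrans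
  rw [fourierInv_compLp] at h5
  rw [mellinUnitary_apply, mellinUnitary_apply]
  filter_upwards [h5, P.coeFn_compLp (FourierTransformInv.fourierInv (logIsometry e hC f) : L2Vec n)]
    with s h6 h7
  rw [h6, h7]
  ext i
  rw [PiLp.smul_apply, hP, smul_eq_mul]
  refine Eq.trans ?_ (dilMat_mulVec e hτ s _ i).symm
  congr 1
  -- The `2π` of the character cancels the denominator in `logMap`.
  rw [Real.fourierChar_apply]
  congr 1
  rw [PiLp.inner_apply]
  simp only [logMap, RCLike.inner_apply, conj_trivial]
  rw [mul_neg, Finset.mul_sum]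
  push_cast
  rw [mul_comm, mul_neg, Finset.mul_sum, Finset.mul_sum]
  congr 1
  refine Finset.sum_congr rfl fun k _ ↦ ?_
  field_simp

end Dilations

/-! ### The symbol: integral formula, continuity, normality. -/

section Symbol

variable {n : ℕ} (e : Fin (2 ^ n) ≃ (Fin n → ℤˣ))

theorem measurable_sign : Measurable Real.sign := by
  unfold Real.sign
  exact Measurable.ite measurableSet_Iio measurable_const
    (Measurable.ite measurableSet_Ioi measurable_const measurable_const)

theorem measurable_dilMat (i j : Fin (2 ^ n)) :
    Measurable fun p : (Fin n → ℝ) × E n ↦ dilMat e p.1 p.2 i j := by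
  simp only [dilMat, Matrix.of_apply]
  have hs : ∀ k, Measurable fun p : (Fin n → ℝ) × E n ↦ Real.log |p.1 k| := fun k ↦
    Real.measurable_log.comp (((measurable_pi_apply k).comp measurable_fst).abs)
  have hs' : ∀ k, Measurable fun p : (Fin n → ℝ) × E n ↦ p.2 k := fun k ↦
    (EuclideanSpace.proj k : E n →L[ℝ] ℝ).continuous.measurable.comp measurable_snd
  refine Measurable.ite ?_ ?_ measurable_const
  · simp only [Set.ofPred_forall]
    refine MeasurableSet.iInter fun k ↦ ?_
    exact measurableSet_eq_fun
      (measurable_sign.comp ((measurable_pi_apply k).comp measurable_fst)) measurable_const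
  · refine Complex.measurable_exp.comp (Measurable.neg (Measurable.const_mul ?_ _))
    exact Finset.measurable_fun_sum _ fun k _ ↦
      (Complex.measurable_ofReal.comp (hs' k)).mul (Complex.measurable_ofReal.comp (hs k))

theorem continuous_dilMat (a : Fin n → ℝ) (i j : Fin (2 ^ n)) :
    Continuous fun s : E n ↦ dilMat e a s i j := by
  simp only [dilMat, Matrix.of_apply]
  split_ifs
  · fun_prop
  · fun_prop

theorem norm_dilMat_le (a : Fin n → ℝ) (s : E n) (i j : Fin (2 ^ n)) : ‖dilMat e a s i j‖ ≤ 1 := by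
  simp only [dilMat, Matrix.of_apply]
  split_ifs
  · rw [Complex.norm_exp]
    have : (-(Complex.I * ∑ k, (s k : ℂ) * (Real.log |a k| : ℂ))).re = 0 := by
      have : (∑ k, (s k : ℂ) * (Real.log |a k| : ℂ)) = ((∑ k, s k * Real.log |a k| : ℝ) : ℂ) := by
        push_cast; rfl
      rw [this]; simp
    rw [this, Real.exp_zero]
  · simp

variable {Ω : Type*} [MeasurableSpace Ω] {μ : Measure Ω} {K : Ω → ℂ}
  {A : Ω → Matrix (Fin n) (Fin n) ℝ} {a : Ω → Fin n → ℝ} {C : Matrix (Fin n) (Fin n) ℝ}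

/-- `|det A(u)|^{-1/2} K(u)`. -/
noncomputable def normalizedKernel (K : Ω → ℂ) (A : Ω → Matrix (Fin n) (Fin n) ℝ) (u : Ω) : ℂ :=
  ((|(A u).det| ^ (-(1 / 2) : ℝ) : ℝ) : ℂ) * K u

/-- With `C` fixed, each `a u k` is a linear combination of the entries of `A u`, so measurability
of `a` need not be assumed. -/
theorem aemeasurable_diagonal (hA : ∀ k l, AEMeasurable (fun u ↦ A u k l) μ)
    (h : ∀ u, Cᵀ * A u * C = Matrix.diagonal (a u)) : AEMeasurable a μ := by
  refine aemeasurable_pi_lambda _ fun k ↦ ?_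
  have h1 : ∀ u, a u k = ∑ j, (∑ i, Cᵀ k i * A u i j) * C j k := fun u ↦ by
    have := congrFun (congrFun (h u) k) k
    rw [Matrix.diagonal_apply_eq] at this
    rw [← this, Matrix.mul_apply]
    simp only [Matrix.mul_apply]
  simp only [h1]
  exact Finset.aemeasurable_fun_sum _ fun j _ ↦ AEMeasurable.mul_const
    (Finset.aemeasurable_fun_sum _ fun i _ ↦ (hA i j).const_mul _) _

/-- The sign condition forces every `a u k` to be nonzero, so the power splits into `|det A
u|^{-1/2}` and a phase. -/
theorem mul_absPow_eq {Ω : Type*} {K : Ω → ℂ} {A : Ω → Matrix (Fin n) (Fin n) ℝ}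
    {a : Ω → Fin n → ℝ} (hC : C ∈ Matrix.orthogonalGroup (Fin n) ℝ)
    (h : ∀ u, Cᵀ * A u * C = Matrix.diagonal (a u)) {i j : Fin (2 ^ n)} {u : Ω}
    (hu : u ∈ signSet a e i j) (s : E n) :
    K u * absPow (a u) (fun k ↦ -(1 / 2 : ℂ) - Complex.I * (s k : ℂ)) =
      normalizedKernel K A u * dilMat e (a u) s i j := by
  have ha : ∀ k, a u k ≠ 0 := fun k ↦ (units_int_mul_abs_of_sign (hu k)).2
  have h1 : absPow (a u) (fun k ↦ -(1 / 2 : ℂ) - Complex.I * (s k : ℂ)) =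
      ((|(A u).det| ^ (-(1 / 2) : ℝ) : ℝ) : ℂ) *
        Complex.exp (-(Complex.I * ∑ k, (s k : ℂ) * (Real.log |a u k| : ℂ))) := by
    rw [det_eq_prod_of_diagonal hC (h u), Finset.abs_prod,
      Real.rpow_def_of_pos (Finset.prod_pos fun k _ ↦ abs_pos.2 (ha k)),
      Real.log_prod fun k _ ↦ (abs_pos.2 (ha k)).ne', Complex.ofReal_exp, ← Complex.exp_add, absPow,
      ← Complex.exp_sum]
    congr 1
    push_cast
    rw [Finset.sum_mul, Finset.mul_sum, ← Finset.sum_neg_distrib, ← Finset.sum_add_distrib]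
    exact Finset.sum_congr rfl fun k _ ↦ by ring
  rw [h1, normalizedKernel, dilMat, Matrix.of_apply, if_pos (show ∀ k, _ from hu)]
  ring

theorem symbol_eq_integral (hA : ∀ k l, AEMeasurable (fun u ↦ A u k l) μ)
    (hC : C ∈ Matrix.orthogonalGroup (Fin n) ℝ)
    (h : ∀ u, Cᵀ * A u * C = Matrix.diagonal (a u)) (s : E n) (i j : Fin (2 ^ n)) :
    symbol μ K a e s i j = ∫ u, normalizedKernel K A u * dilMat e (a u) s i j ∂μ := by
  have hset : NullMeasurableSet (signSet a e i j) μ := by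
    have : MeasurableSet {b : Fin n → ℝ | ∀ k, Real.sign (b k) = (((eps e i j k : ℤˣ) : ℤ) : ℝ)} := by
      simp only [Set.ofPred_forall]
      exact MeasurableSet.iInter fun k ↦ measurableSet_eq_fun
        (measurable_sign.comp (measurable_pi_apply k)) measurable_const
    exact (aemeasurable_diagonal hA h).nullMeasurableSet_preimage this
  rw [symbol, Matrix.of_apply, ← integral_indicator₀ hset]
  refine integral_congr_ae (ae_of_all _ fun u ↦ ?_)
  by_cases hu : u ∈ signSet a e i j
  · rw [Set.indicator_of_mem hu]
    exact mul_absPow_eq e hC h hu s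
  · rw [Set.indicator_of_notMem hu]
    simp only [dilMat, Matrix.of_apply]
    rw [if_neg (show ¬ ∀ k, _ from hu), mul_zero]

/-- The entries of `dilMat` are continuous in `s` and bounded by `1`, so `|normalizedKernel|`
dominates. -/
theorem exists_boundedContinuous_symbol (hA : ∀ k l, AEMeasurable (fun u ↦ A u k l) μ)
    (hK : Integrable (normalizedKernel K A) μ) (hC : C ∈ Matrix.orthogonalGroup (Fin n) ℝ)
    (h : ∀ u, Cᵀ * A u * C = Matrix.diagonal (a u)) :
    ∃ Φ : Matrix (Fin (2 ^ n)) (Fin (2 ^ n)) (E n →ᵇ ℂ),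
      ∀ i j s, Φ i j s = symbol μ K a e s i j := by
  have hle : ∀ i j s u, ‖normalizedKernel K A u * dilMat e (a u) s i j‖ ≤
      ‖normalizedKernel K A u‖ := fun i j s u ↦ by
    rw [norm_mul]
    exact mul_le_of_le_one_right (norm_nonneg _) (norm_dilMat_le e _ s i j)
  have hmeas : ∀ i j s, AEStronglyMeasurable (fun u ↦ dilMat e (a u) s i j) μ := fun i j s ↦
    ((measurable_dilMat e i j).comp_aemeasurable
      ((aemeasurable_diagonal hA h).prodMk aemeasurable_const)).aestronglyMeasurable
  refine ⟨Matrix.of fun i j ↦ BoundedContinuousFunction.ofNormedAddCommGroup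
    (fun s ↦ symbol μ K a e s i j) ?_ (∫ u, ‖normalizedKernel K A u‖ ∂μ) fun s ↦ ?_,
    fun i j s ↦ rfl⟩
  · simp only [symbol_eq_integral e hA hC h]
    refine continuous_of_dominated (bound := fun u ↦ ‖normalizedKernel K A u‖)
      (fun s ↦ hK.1.mul (hmeas i j s)) (fun s ↦ ae_of_all _ (hle i j s)) hK.norm
      (ae_of_all _ fun u ↦ (continuous_dilMat e (a u) i j).const_mul _)
  · rw [symbol_eq_integral e hA hC h]
    exact norm_integral_le_of_norm_le hK.norm (ae_of_all _ (hle i j s))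

/-- Such a matrix is a convolution operator on a commutative group. Concretely, the reflection `k ↦
i j / k` of the summation index exchanges the two products. -/
theorem isStarNormal_group_matrix {ι G : Type*} [Fintype ι] [DecidableEq ι] [CommGroup G]
    (e : ι ≃ G) (c : G → ℂ) :
    IsStarNormal (Matrix.of fun i j ↦ c (e j * (e i)⁻¹) : Matrix ι ι ℂ) := by
  refine ⟨?_⟩
  ext i j
  simp only [Matrix.star_eq_conjTranspose, Matrix.mul_apply, Matrix.conjTranspose_apply,
    Matrix.of_apply]
  let φ : ι ≃ ι := e.trans ((Equiv.divLeft (e i * e j)).trans e.symm)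
  rw [← Equiv.sum_comp φ]
  refine Finset.sum_congr rfl fun k _ ↦ ?_
  have hφ : e (φ k) = e i * e j / e k := by simp [φ]
  have h1 : ∀ x y : G, x * (x * y / e k)⁻¹ = e k * y⁻¹ := fun x y ↦ by
    rw [inv_div, mul_div_assoc', mul_div_mul_comm]
    simp [div_eq_mul_inv]
  rw [hφ, h1, mul_comm (e i) (e j), h1, mul_comm]

theorem isStarNormal_symbol (μ : Measure Ω) (K : Ω → ℂ) (a : Ω → Fin n → ℝ) (s : E n) :
    IsStarNormal (symbol μ K a e s) :=
  isStarNormal_group_matrix e fun ε ↦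
    ∫ u in {u | ∀ k, Real.sign (a u k) = (((ε k : ℤˣ) : ℤ) : ℝ)},
      K u * absPow (a u) (fun k ↦ -(1 / 2 : ℂ) - Complex.I * (s k : ℂ)) ∂μ

end Symbol

/-! ### Simultaneous orthogonal diagonalization. -/

section Diagonalization

variable {n : ℕ}

/-- Commuting symmetric operators split the space into orthogonal joint eigenspaces; the columns of
`C` are an orthonormal basis subordinate to them. -/
theorem exists_orthogonal_diagonalization {Ω : Type*} (A : Ω → Matrix (Fin n) (Fin n) ℝ)
    (hA : ∀ u, (A u).IsHermitian) (hcomm : ∀ u v, Commute (A u) (A v)) :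
    ∃ C ∈ Matrix.orthogonalGroup (Fin n) ℝ, ∃ a : Ω → Fin n → ℝ,
      ∀ u, Cᵀ * A u * C = Matrix.diagonal (a u) := by
  classical
  let T : Ω → E n →ₗ[ℝ] E n := fun u ↦ Matrix.toEuclideanLin (A u)
  have hT : ∀ u, (T u).IsSymmetric := fun u ↦ Matrix.isSymmetric_toEuclideanLin_iff.2 (hA u)
  have hTcomm : Pairwise (Function.onFun Commute T) := fun u v _ ↦ by
    refine LinearMap.ext fun x ↦ ?_
    change act (A u) (act (A v) x) = act (A v) (act (A u) x)
    rw [act_act, act_act, (hcomm u v).eq]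
  let W : (Ω → ℝ) → Submodule ℝ (E n) := fun χ ↦ ⨅ u, Module.End.eigenspace (T u) (χ u)
  have hint : DirectSum.IsInternal W :=
    LinearMap.IsSymmetric.directSum_isInternal_of_pairwise_commute hT hTcomm
  -- `Ω` may be infinite, but independence in finite dimension leaves finitely many nonzero joint
  -- eigenspaces.
  have hfin : {χ | W χ ≠ ⊥}.Finite :=
    WellFoundedGT.finite_ne_bot_of_iSupIndep hint.submodule_iSupIndep
  have : Fintype {χ // W χ ≠ ⊥} := hfin.fintype
  have hint' : DirectSum.IsInternal (fun χ : {χ // W χ ≠ ⊥} ↦ W χ) :=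
    DirectSum.isInternal_ne_bot_iff.2 hint
  have horth := (LinearMap.IsSymmetric.orthogonalFamily_iInf_eigenspaces hT).comp
    (Subtype.val_injective (p := fun χ : Ω → ℝ ↦ W χ ≠ ⊥))
  have hn : Module.finrank ℝ (E n) = n := by simp
  let b := hint'.subordinateOrthonormalBasis hn horth
  let χ : Fin n → Ω → ℝ := fun k ↦ (hint'.subordinateOrthonormalBasisIndex hn k horth).1
  have hb : ∀ k u, act (A u) (b k) = χ k u • b k := fun k u ↦ by
    have h1 := hint'.subordinateOrthonormalBasis_subordinate hn k horth
    exact Module.End.mem_eigenspace_iff.1 ((Submodule.mem_iInf _).1 h1 u)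
  have hin : ∀ k l, ∑ i, b k i * b l i = if k = l then 1 else 0 := fun k l ↦ by
    have := orthonormal_iff_ite.1 b.orthonormal l k
    rw [PiLp.inner_apply] at this
    simpa [eq_comm] using this
  refine ⟨Matrix.of fun i k ↦ b k i, (Matrix.mem_orthogonalGroup_iff' _ _).2 ?_,
    fun u k ↦ χ k u, fun u ↦ ?_⟩
  · ext k l
    change (∑ i, b k i * b l i) = _
    rw [hin, Matrix.one_apply]
  · ext k l
    rw [mul_assoc, Matrix.mul_apply]
    have h1 : ∀ i, (A u * Matrix.of fun i k ↦ b k i) i l = χ l u * b l i := fun i ↦ by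
      have := congrArg (fun v : E n ↦ v i) (hb l u)
      exact this
    simp only [h1, Matrix.transpose_apply, Matrix.of_apply, mul_left_comm _ (χ l u)]
    rw [← Finset.mul_sum, hin, Matrix.diagonal_apply]
    split_ifs with h
    · rw [h, mul_one]
    · rw [mul_zero]

end Diagonalization

/-! ### The Hausdorff operator as a superposition of dilations. -/

section HausdorffOperator

open scoped ENNReal InnerProductSpace

variable {n : ℕ} {Ω : Type*} [MeasurableSpace Ω] {μ : Measure Ω} {K : Ω → ℂ}
  {A : Ω → Matrix (Fin n) (Fin n) ℝ}

/-- The unitary dilation `f ↦ |det B|^{1/2} f(B x)`, on functions. -/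
noncomputable def dilation (B : Matrix (Fin n) (Fin n) ℝ) (f : E n → ℂ) (x : E n) : ℂ :=
  (√|B.det| : ℂ) * f (act B x)

theorem normalizedKernel_smul_dilation {Ω : Type*} {K : Ω → ℂ}
    {A : Ω → Matrix (Fin n) (Fin n) ℝ} {u : Ω} (hu : K u ≠ 0 → (A u).det ≠ 0) (f : E n → ℂ)
    (x : E n) : normalizedKernel K A u • dilation (A u) f x = K u * f (act (A u) x) := by
  by_cases hK : K u = 0
  · simp [normalizedKernel, hK]
  · have h0 : 0 < |(A u).det| := abs_pos.2 (hu hK)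
    have h1 : |(A u).det| ^ (-(1 / 2) : ℝ) * √|(A u).det| = 1 := by
      rw [Real.sqrt_eq_rpow, ← Real.rpow_add h0]; norm_num
    have h2 : ((|(A u).det| ^ (-(1 / 2) : ℝ) : ℝ) : ℂ) * (√|(A u).det| : ℂ) = 1 := by
      exact_mod_cast h1
    rw [normalizedKernel, dilation, smul_eq_mul]
    linear_combination (K u * f (act (A u) x)) * h2

/-- Equality holds for nonsingular `B`; for singular `B` the prefactor vanishes. The inequality is
thus uniform in `u`, including where `K u = 0` and `A u` is singular. -/
theorem lintegral_dilation_le (B : Matrix (Fin n) (Fin n) ℝ) {f : E n → ℂ}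
    (hf : StronglyMeasurable f) : ∫⁻ x, ‖dilation B f x‖ₑ ^ 2 ≤ ∫⁻ x, ‖f x‖ₑ ^ 2 := by
  by_cases hB : B.det = 0
  · simp [dilation, hB]
  · have h0 : 0 < |B.det| := abs_pos.2 hB
    have h1 : ∀ x, ‖dilation B f x‖ₑ ^ 2 = ENNReal.ofReal |B.det| * ‖f (act B x)‖ₑ ^ 2 := fun x ↦ by
      rw [dilation, enorm_mul, mul_pow]
      congr 1
      rw [← ofReal_norm, Complex.norm_real, Real.norm_of_nonneg (Real.sqrt_nonneg _),
        ← ENNReal.ofReal_pow (Real.sqrt_nonneg _), Real.sq_sqrt h0.le]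
    simp only [h1]
    have hm : Measurable fun x ↦ ‖f (act B x)‖ₑ ^ 2 :=
      (hf.enorm.pow_const 2).comp (continuous_act B).measurable
    rw [lintegral_const_mul _ hm,
      lintegral_comp_act hB (h := fun x ↦ ‖f x‖ₑ ^ 2) (hf.enorm.pow_const 2), ← mul_assoc,
      ← ENNReal.ofReal_mul h0.le, mul_inv_cancel₀ h0.ne']
    simp

theorem stronglyMeasurable_dilation (B : Matrix (Fin n) (Fin n) ℝ) {f : E n → ℂ}
    (hf : StronglyMeasurable f) : StronglyMeasurable (dilation B f) :=
  stronglyMeasurable_const.mul (hf.comp_measurable (continuous_act B).measurable)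

/-- `A` is replaced by an entrywise measurable version. Genuine measurability of `f` is required
because a singular `A u` may map into a null set. -/
theorem aestronglyMeasurable_uncurry_dilation [SFinite μ] (hA : ∀ k l, AEMeasurable (fun u ↦ A u k l) μ)
    {f : E n → ℂ} (hf : StronglyMeasurable f) :
    AEStronglyMeasurable (Function.uncurry fun u ↦ dilation (A u) f)
      (μ.prod (volume : Measure (E n))) := by
  let A' : Ω → Matrix (Fin n) (Fin n) ℝ := fun u ↦ Matrix.of fun k l ↦ (hA k l).mk _ u
  have hA' : ∀ k l, Measurable fun u ↦ A' u k l := fun k l ↦ (hA k l).measurable_mk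
  have hAA' : ∀ᵐ u ∂μ, A u = A' u := by
    filter_upwards [ae_all_iff.2 fun k ↦ ae_all_iff.2 fun l ↦ (hA k l).ae_eq_mk] with u hu
    ext k l
    exact hu k l
  have hdet : Measurable fun u ↦ (A' u).det := by
    simp only [Matrix.det_apply]
    exact Finset.measurable_fun_sum _ fun σ _ ↦
      (Finset.measurable_fun_prod _ fun k _ ↦ hA' _ _).const_smul _
  have hact : Measurable fun p : Ω × E n ↦ act (A' p.1) p.2 := by
    refine (PiLp.continuous_toLp 2 _).measurable.comp (measurable_pi_lambda _ fun k ↦ ?_)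
    simp only [Matrix.mulVec, dotProduct]
    exact Finset.measurable_fun_sum _ fun l _ ↦ ((hA' k l).comp measurable_fst).mul
      ((EuclideanSpace.proj l : E n →L[ℝ] ℝ).continuous.measurable.comp measurable_snd)
  have hsqrt : Measurable fun p : Ω × E n ↦ (√|(A' p.1).det| : ℂ) :=
    Complex.measurable_ofReal.comp
      (Real.continuous_sqrt.measurable.comp (hdet.comp measurable_fst).abs)
  refine ⟨fun p ↦ (√|(A' p.1).det| : ℂ) * f (act (A' p.1) p.2),
    hsqrt.stronglyMeasurable.mul (hf.comp_measurable hact), ?_⟩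
  filter_upwards [Measure.quasiMeasurePreserving_fst.ae hAA'] with p hp
  simp only [Function.uncurry, dilation]
  rw [hp]

/-- The value of the Hausdorff operator, as a function. -/
noncomputable def hausdorffFun (μ : Measure Ω) (K : Ω → ℂ) (A : Ω → Matrix (Fin n) (Fin n) ℝ)
    (f : E n → ℂ) (x : E n) : ℂ :=
  ∫ u, K u * f (act (A u) x) ∂μ

theorem hausdorffFun_eq (hns : ∀ᵐ u ∂μ, K u ≠ 0 → (A u).det ≠ 0) (f : E n → ℂ) (x : E n) :
    hausdorffFun μ K A f x = ∫ u, normalizedKernel K A u • dilation (A u) f x ∂μ := by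
  refine integral_congr_ae ?_
  filter_upwards [hns] with u hu
  exact (normalizedKernel_smul_dilation hu f x).symm

theorem lintegral_sq_Lp_lt_top {X F : Type*} [MeasurableSpace X] [NormedAddCommGroup F]
    {ν : Measure X} (f : Lp F 2 ν) : ∫⁻ x, ‖f x‖ₑ ^ 2 ∂ν < ∞ :=
  (memLp_two_iff (Lp.aestronglyMeasurable f)).1 (Lp.memLp f)

theorem ae_integrable_hausdorff [SigmaFinite μ] (hA : ∀ k l, AEMeasurable (fun u ↦ A u k l) μ)
    (hns : ∀ᵐ u ∂μ, K u ≠ 0 → (A u).det ≠ 0) (hK : Integrable (normalizedKernel K A) μ)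
    (f : L2 n) : ∀ᵐ x : E n, Integrable (fun u ↦ K u * f (act (A u) x)) μ := by
  have hf := Lp.stronglyMeasurable f
  filter_upwards [ae_integrable_superposition hK (aestronglyMeasurable_uncurry_dilation hA hf)
    (lintegral_sq_Lp_lt_top f).ne (ae_of_all _ fun u ↦ lintegral_dilation_le (A u) hf)] with x hx
  refine hx.congr ?_
  filter_upwards [hns] with u hu
  exact normalizedKernel_smul_dilation hu f x

theorem memLp_hausdorffFun [SigmaFinite μ] (hA : ∀ k l, AEMeasurable (fun u ↦ A u k l) μ)
    (hns : ∀ᵐ u ∂μ, K u ≠ 0 → (A u).det ≠ 0) (hK : Integrable (normalizedKernel K A) μ)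
    (f : L2 n) : MemLp (hausdorffFun μ K A f) 2 := by
  have hf := Lp.stronglyMeasurable f
  have hm := aestronglyMeasurable_uncurry_dilation hA hf
  have h1 : hausdorffFun μ K A f =
      fun x ↦ ∫ u, normalizedKernel K A u • dilation (A u) f x ∂μ :=
    funext (hausdorffFun_eq hns f)
  rw [h1, memLp_two_iff (aestronglyMeasurable_superposition hK hm)]
  exact (lintegral_sq_superposition_le hK hm
    (ae_of_all _ fun u ↦ lintegral_dilation_le (A u) hf)).trans_lt
    (ENNReal.mul_lt_top (ENNReal.pow_lt_top hK.2) (lintegral_sq_Lp_lt_top f))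

theorem inner_toLp_right {X F : Type*} [MeasurableSpace X] [NormedAddCommGroup F]
    [InnerProductSpace ℂ F] {ν : Measure X} (h : Lp F 2 ν) {g : X → F} (hg : MemLp g 2 ν) :
    ⟪h, hg.toLp⟫_ℂ = ∫ x, ⟪h x, g x⟫_ℂ ∂ν := by
  rw [L2.inner_def]
  refine integral_congr_ae ?_
  filter_upwards [hg.coeFn_toLp] with x hx
  rw [hx]

variable {a : Ω → Fin n → ℝ} {C : Matrix (Fin n) (Fin n) ℝ} (e : Fin (2 ^ n) ≃ (Fin n → ℤˣ))

/-- The action of `dilMat` on vector functions. -/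
noncomputable def dilVec (b : Fin n → ℝ) (g : E n → CVec n) (s : E n) : CVec n :=
  WithLp.toLp 2 (dilMat e b s *ᵥ WithLp.ofLp (g s))

theorem norm_dilVec_le (b : Fin n → ℝ) (g : E n → CVec n) (s : E n) :
    ‖dilVec e b g s‖ ≤ ((2 ^ n : ℕ) : ℝ) ^ 2 * ‖g s‖ := by
  refine (norm_toLp_mulVec_le _ _).trans (mul_le_mul_of_nonneg_right ?_ (norm_nonneg _))
  calc ∑ i, ∑ j, ‖dilMat e b s i j‖ ≤ ∑ i : Fin (2 ^ n), ∑ j : Fin (2 ^ n), (1 : ℝ) :=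
        Finset.sum_le_sum fun i _ ↦ Finset.sum_le_sum fun j _ ↦ norm_dilMat_le e b s i j
    _ = _ := by simp [sq]

theorem lintegral_dilVec_le (b : Fin n → ℝ) (g : E n → CVec n) :
    ∫⁻ s, ‖dilVec e b g s‖ₑ ^ 2 ≤
      ENNReal.ofReal (((2 ^ n : ℕ) : ℝ) ^ 2) ^ 2 * ∫⁻ s, ‖g s‖ₑ ^ 2 := by
  rw [← lintegral_const_mul' _ _ (by finiteness)]
  refine lintegral_mono fun s ↦ ?_
  rw [← mul_pow, ← ofReal_norm, ← ofReal_norm, ← ENNReal.ofReal_mul (by positivity)]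
  exact pow_le_pow_left' (ENNReal.ofReal_le_ofReal (norm_dilVec_le e b g s)) 2

theorem aestronglyMeasurable_uncurry_dilVec [SFinite μ] (ha : AEMeasurable a μ) {g : E n → CVec n}
    (hg : StronglyMeasurable g) :
    AEStronglyMeasurable (Function.uncurry fun u ↦ dilVec e (a u) g)
      (μ.prod (volume : Measure (E n))) := by
  have h1 : AEMeasurable (fun p : Ω × E n ↦ (a p.1, p.2)) (μ.prod (volume : Measure (E n))) :=
    (ha.comp_quasiMeasurePreserving Measure.quasiMeasurePreserving_fst).prodMk
      measurable_snd.aemeasurable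
  refine AEMeasurable.aestronglyMeasurable ?_
  refine (PiLp.continuous_toLp 2 _).measurable.comp_aemeasurable
    (aemeasurable_pi_lambda _ fun i ↦ ?_)
  simp only [Matrix.mulVec, dotProduct]
  exact Finset.aemeasurable_fun_sum _ fun j _ ↦
    ((measurable_dilMat e i j).comp_aemeasurable h1).mul
      (((EuclideanSpace.proj j : CVec n →L[ℂ] ℂ).continuous.measurable.comp
        (hg.measurable.comp measurable_snd)).aemeasurable)

theorem integral_dilVec (hA : ∀ k l, AEMeasurable (fun u ↦ A u k l) μ)
    (hK : Integrable (normalizedKernel K A) μ) (hC : C ∈ Matrix.orthogonalGroup (Fin n) ℝ)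
    (h : ∀ u, Cᵀ * A u * C = Matrix.diagonal (a u)) (g : E n → CVec n) (s : E n) :
    ∫ u, normalizedKernel K A u • dilVec e (a u) g s ∂μ =
      WithLp.toLp 2 (symbol μ K a e s *ᵥ WithLp.ofLp (g s)) := by
  have hmeas : ∀ i j, AEStronglyMeasurable (fun u ↦ dilMat e (a u) s i j) μ := fun i j ↦
    ((measurable_dilMat e i j).comp_aemeasurable
      ((aemeasurable_diagonal hA h).prodMk aemeasurable_const)).aestronglyMeasurable
  have hint : ∀ i j, Integrable (fun u ↦ normalizedKernel K A u * dilMat e (a u) s i j) μ :=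
    fun i j ↦ hK.mul_bdd (hmeas i j) (ae_of_all _ fun u ↦ norm_dilMat_le e _ s i j)
  have hcomp : ∀ u i, (normalizedKernel K A u • dilVec e (a u) g s) i =
      ∑ j, normalizedKernel K A u * dilMat e (a u) s i j * g s j := fun u i ↦ by
    simp only [dilVec, PiLp.smul_apply, Matrix.mulVec, dotProduct, smul_eq_mul, Finset.mul_sum,
      mul_assoc]
  have hvec : Integrable (fun u ↦ normalizedKernel K A u • dilVec e (a u) g s) μ := by
    have h1 : Integrable (fun u ↦ WithLp.ofLp (normalizedKernel K A u • dilVec e (a u) g s)) μ := by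
      refine Integrable.of_eval fun i ↦ ?_
      simp only [hcomp]
      exact integrable_finsetSum _ fun j _ ↦ (hint i j).mul_const _
    exact (PiLp.continuousLinearEquiv 2 ℂ
      (fun _ : Fin (2 ^ n) ↦ ℂ)).symm.toContinuousLinearMap.integrable_comp h1
  ext i
  have h2 := (EuclideanSpace.proj i : CVec n →L[ℂ] ℂ).integral_comp_comm hvec
  refine h2.symm.trans ?_
  change ∫ u, (normalizedKernel K A u • dilVec e (a u) g s) i ∂μ = _
  simp only [hcomp]
  rw [integral_finsetSum _ fun j _ ↦ (hint i j).mul_const _]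
  simp only [integral_mul_const, ← symbol_eq_integral e hA hC h]
  rfl

/-- Pairing with `g` moves the unitary to the other side. Fubini then reduces the claim to single
dilations, and Fubini in reverse reassembles the symbol. -/
theorem mellinUnitary_hausdorff [SigmaFinite μ] (hA : ∀ k l, AEMeasurable (fun u ↦ A u k l) μ)
    (hns : ∀ᵐ u ∂μ, K u ≠ 0 → (A u).det ≠ 0) (hK : Integrable (normalizedKernel K A) μ)
    (hC : C ∈ Matrix.orthogonalGroup (Fin n) ℝ)
    (h : ∀ u, Cᵀ * A u * C = Matrix.diagonal (a u)) (f F : L2 n)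
    (hF : F =ᵐ[volume] hausdorffFun μ K A f)
    {Φ : Matrix (Fin (2 ^ n)) (Fin (2 ^ n)) (E n →ᵇ ℂ)}
    (hΦ : ∀ i j s, Φ i j s = symbol μ K a e s i j) :
    mellinUnitary e hC F = mulOp volume Φ (mellinUnitary e hC f) := by
  set V := mellinUnitary e hC with hV
  have hf := Lp.stronglyMeasurable f
  have hVf := Lp.stronglyMeasurable (V f)
  have hm := aestronglyMeasurable_uncurry_dilation hA hf
  have hm' := aestronglyMeasurable_uncurry_dilVec e (aemeasurable_diagonal hA h) hVf
  have hR := lintegral_sq_Lp_lt_top f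
  have hR' : ENNReal.ofReal (((2 ^ n : ℕ) : ℝ) ^ 2) ^ 2 * ∫⁻ s, ‖V f s‖ₑ ^ 2 ≠ ∞ :=
    ENNReal.mul_ne_top (by finiteness) (lintegral_sq_Lp_lt_top (V f)).ne
  refine ext_inner_left ℂ fun g ↦ ?_
  have hmem : ∀ u, MemLp (dilation (A u) f) 2 := fun u ↦
    (memLp_two_iff (stronglyMeasurable_dilation (A u) hf).aestronglyMeasurable).2
      ((lintegral_dilation_le (A u) hf).trans_lt hR)
  have hpt : ∀ᵐ u ∂μ, ∫ x, ⟪V.symm g x, normalizedKernel K A u • dilation (A u) f x⟫_ℂ =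
      ∫ s, ⟪g s, normalizedKernel K A u • dilVec e (a u) (V f) s⟫_ℂ := by
    filter_upwards [hns] with u hu
    simp only [inner_smul_right]
    rw [integral_const_mul, integral_const_mul]
    -- Where `K u = 0` the matrix may be singular, but both sides carry a zero factor.
    by_cases hk : K u = 0
    · simp [normalizedKernel, hk]
    congr 1
    rw [← inner_toLp_right _ (hmem u), ← V.inner_map_map, V.apply_symm_apply, L2.inner_def]
    refine integral_congr_ae ?_
    filter_upwards [mellinUnitary_dilation e hC (h u) (hu hk) f _ (hmem u).coeFn_toLp] with s hs
    rw [hV, hs]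
    rfl
  calc ⟪g, V F⟫_ℂ = ⟪V.symm g, F⟫_ℂ := by
        rw [← V.inner_map_map (V.symm g) F, V.apply_symm_apply]
    _ = ∫ x, ⟪V.symm g x, ∫ u, normalizedKernel K A u • dilation (A u) f x ∂μ⟫_ℂ := by
        rw [L2.inner_def]
        refine integral_congr_ae ?_
        filter_upwards [hF] with x hx
        rw [hx, hausdorffFun_eq hns]
    _ = ∫ u, (∫ x, ⟪V.symm g x, normalizedKernel K A u • dilation (A u) f x⟫_ℂ) ∂μ :=
        integral_inner_superposition hK hm hR.ne
          (ae_of_all _ fun u ↦ lintegral_dilation_le (A u) hf) (Lp.memLp _)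
    _ = ∫ u, (∫ s, ⟪g s, normalizedKernel K A u • dilVec e (a u) (V f) s⟫_ℂ) ∂μ :=
        integral_congr_ae hpt
    _ = ∫ s, ⟪g s, ∫ u, normalizedKernel K A u • dilVec e (a u) (V f) s ∂μ⟫_ℂ :=
        (integral_inner_superposition hK hm' hR'
          (ae_of_all _ fun u ↦ lintegral_dilVec_le e (a u) _) (Lp.memLp _)).symm
    _ = ⟪g, mulOp volume Φ (V f)⟫_ℂ := by
        rw [L2.inner_def]
        refine integral_congr_ae ?_
        filter_upwards [coeFn_mulOp Φ (V f)] with s hs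
        rw [hs, integral_dilVec e hA hK hC h]
        congr 4
        ext i j
        exact (hΦ i j s).symm

end HausdorffOperator

/-! ### Transport along a unitary, and the theorem. -/

theorem conjStarAlgEquiv_eq_of_intertwines {Y Z : Type*} [NormedAddCommGroup Y] [InnerProductSpace ℂ Y]
    [CompleteSpace Y] [NormedAddCommGroup Z] [InnerProductSpace ℂ Z] [CompleteSpace Z]
    (V : Y ≃ₗᵢ[ℂ] Z) {H : Y →L[ℂ] Y} {M : Z →L[ℂ] Z} (h : ∀ f, V (H f) = M (V f)) :
    V.conjStarAlgEquiv H = M := by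
  ext1 g
  rw [LinearIsometryEquiv.conjStarAlgEquiv_apply_apply, h, V.apply_symm_apply]

theorem pointSpectrum_conj {Y Z : Type*} [NormedAddCommGroup Y] [InnerProductSpace ℂ Y]
    [NormedAddCommGroup Z] [InnerProductSpace ℂ Z]
    (V : Y ≃ₗᵢ[ℂ] Z) {H : Y →L[ℂ] Y} {M : Z →L[ℂ] Z} (h : ∀ f, V (H f) = M (V f)) :
    pointSpectrum H = pointSpectrum M := by
  ext z
  constructor
  · rintro ⟨f, hf, hz⟩
    exact ⟨V f, by simpa using hf, by rw [← h, hz, map_smul]⟩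
  · rintro ⟨g, hg, hz⟩
    refine ⟨V.symm g, by simpa using hg, V.injective ?_⟩
    rw [h, V.apply_symm_apply, hz, map_smul, V.apply_symm_apply]

end Hausdorff

theorem theorem1 {Ω : Type*} [MeasurableSpace Ω] (μ : Measure Ω) [SigmaFinite μ] (n : ℕ)
    (K : Ω → ℂ) (A : Ω → Matrix (Fin n) (Fin n) ℝ)
    (hA_meas : ∀ k l, AEMeasurable (fun u => A u k l) μ)
    (hA_nonsing : ∀ᵐ u ∂μ, K u ≠ 0 → (A u).det ≠ 0)
    (hA_selfadj : ∀ u, (A u).IsHermitian)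
    (hA_comm : ∀ u v, Commute (A u) (A v))
    (hK : Integrable (fun u => ((|(A u).det| ^ (-(1 / 2) : ℝ) : ℝ) : ℂ) * K u) μ) :
    -- the family can be diagonalized simultaneously by an orthogonal matrix
    (∃ C ∈ Matrix.orthogonalGroup (Fin n) ℝ, ∃ a : Ω → Fin n → ℝ,
      ∀ u, Cᵀ * A u * C = Matrix.diagonal (a u)) ∧
    -- the Hausdorff operator is a bounded normal operator with empty residual spectrum
    ∃ H : Hausdorff.L2 n →L[ℂ] Hausdorff.L2 n,
      Hausdorff.IsHausdorffOperator μ K A H ∧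
      IsStarNormal H ∧
      Hausdorff.residualSpectrum H = ∅ ∧
      -- for every diagonalization and every enumeration of the hyperoctants
      ∀ C ∈ Matrix.orthogonalGroup (Fin n) ℝ, ∀ a : Ω → Fin n → ℝ,
        (∀ u, Cᵀ * A u * C = Matrix.diagonal (a u)) →
        ∀ e : Fin (2 ^ n) ≃ (Fin n → ℤˣ),
          -- the symbol is pointwise normal
          (∀ s, IsStarNormal (Hausdorff.symbol μ K a e s)) ∧
          -- unitary equivalence to multiplication by the symbol
          (∃ (V : Hausdorff.L2 n ≃ₗᵢ[ℂ] Hausdorff.L2Vec n)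
              (M : Hausdorff.L2Vec n →L[ℂ] Hausdorff.L2Vec n),
            Hausdorff.IsMellinTransform C e V ∧
            Hausdorff.IsMultiplicationOperator (Hausdorff.symbol μ K a e) M ∧
            ∀ f, V (H f) = M (V f)) ∧
          -- the symbol is a matrix over the bounded continuous functions, with the same spectrum
          (∃ Φ : Matrix (Fin (2 ^ n)) (Fin (2 ^ n)) (Hausdorff.E n →ᵇ ℂ),
            (∀ i j s, Φ i j s = Hausdorff.symbol μ K a e s i j) ∧
            spectrum ℂ H = spectrum ℂ Φ) ∧
          spectrum ℂ H =
            {z : ℂ | ⨅ s : Hausdorff.E n,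
              ‖(z • (1 : Matrix (Fin (2 ^ n)) (Fin (2 ^ n)) ℂ)
                - Hausdorff.symbol μ K a e s).det‖ = 0} ∧
          (∀ z : ℂ, IsClosed {s : Hausdorff.E n |
            (z • (1 : Matrix (Fin (2 ^ n)) (Fin (2 ^ n)) ℂ)
              - Hausdorff.symbol μ K a e s).det = 0}) ∧
          Hausdorff.pointSpectrum H =
            {z : ℂ | 0 < volume {s : Hausdorff.E n |
              (z • (1 : Matrix (Fin (2 ^ n)) (Fin (2 ^ n)) ℂ)
                - Hausdorff.symbol μ K a e s).det = 0}} := by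
  refine ⟨Hausdorff.exists_orthogonal_diagonalization A hA_selfadj hA_comm, ?_⟩
  -- One auxiliary diagonalization and enumeration define `H` by conjugation; `hH` then identifies
  -- it by a formula free of these choices.
  obtain ⟨C₀, hC₀, a₀, h₀⟩ := Hausdorff.exists_orthogonal_diagonalization A hA_selfadj hA_comm
  let e₀ : Fin (2 ^ n) ≃ (Fin n → ℤˣ) := Fintype.equivOfCardEq (by simp)
  have hK' : Integrable (Hausdorff.normalizedKernel K A) μ := hK
  obtain ⟨Φ₀, hΦ₀⟩ := Hausdorff.exists_boundedContinuous_symbol e₀ hA_meas hK' hC₀ h₀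
  have heval : ∀ (a : Ω → Fin n → ℝ) (e : Fin (2 ^ n) ≃ (Fin n → ℤˣ))
      (Φ : Matrix (Fin (2 ^ n)) (Fin (2 ^ n)) (Hausdorff.E n →ᵇ ℂ)),
      (∀ i j s, Φ i j s = Hausdorff.symbol μ K a e s i j) →
      ∀ s, Hausdorff.evalMat s Φ = Hausdorff.symbol μ K a e s := fun a e Φ h s ↦ by
    ext i j
    exact h i j s
  let V₀ := Hausdorff.mellinUnitary e₀ hC₀
  let H : Hausdorff.L2 n →L[ℂ] Hausdorff.L2 n :=
    V₀.symm.conjStarAlgEquiv (Hausdorff.mulOp volume Φ₀)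
  have hH : ∀ f, H f =ᵐ[volume] Hausdorff.hausdorffFun μ K A f := fun f ↦ by
    have hmem := Hausdorff.memLp_hausdorffFun hA_meas hA_nonsing hK' f
    have h1 := Hausdorff.mellinUnitary_hausdorff e₀ hA_meas hA_nonsing hK' hC₀ h₀ f _
      hmem.coeFn_toLp hΦ₀
    have h2 : H f = hmem.toLp := by
      refine V₀.injective (Eq.trans ?_ h1.symm)
      exact V₀.apply_symm_apply _
    rw [h2]
    exact hmem.coeFn_toLp
  have hHnormal : IsStarNormal H := by
    have hM : IsStarNormal (Hausdorff.mulOp (volume : Measure (Hausdorff.E n)) Φ₀) :=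
      Hausdorff.isStarNormal_mulOp fun s ↦ by
        rw [heval a₀ e₀ Φ₀ hΦ₀ s]
        exact Hausdorff.isStarNormal_symbol e₀ μ K a₀ s
    exact hM.map V₀.symm.conjStarAlgEquiv
  refine ⟨H, fun f ↦ ?_, hHnormal, Hausdorff.residualSpectrum_eq_empty hHnormal,
    fun C hC a h e ↦ ⟨Hausdorff.isStarNormal_symbol e μ K a, ?_⟩⟩
  · filter_upwards [hH f, Hausdorff.ae_integrable_hausdorff hA_meas hA_nonsing hK' f] with x h1 h2
    exact ⟨h2, h1⟩
  obtain ⟨Φ, hΦ⟩ := Hausdorff.exists_boundedContinuous_symbol e hA_meas hK' hC h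
  have hΦ' := heval a e Φ hΦ
  -- Only the formula `hH` enters, so the given `C`, `a`, `e` may differ from those used to
  -- construct `H`.
  have hV : ∀ f, Hausdorff.mellinUnitary e hC (H f) =
      Hausdorff.mulOp volume Φ (Hausdorff.mellinUnitary e hC f) := fun f ↦
    Hausdorff.mellinUnitary_hausdorff e hA_meas hA_nonsing hK' hC h f (H f) (hH f) hΦ
  have hspec : spectrum ℂ H =
      spectrum ℂ (Hausdorff.mulOp (volume : Measure (Hausdorff.E n)) Φ) := by
    have := AlgEquiv.spectrum_eq (R := ℂ) (Hausdorff.mellinUnitary e hC).conjStarAlgEquiv H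
    rw [Hausdorff.conjStarAlgEquiv_eq_of_intertwines _ hV] at this
    exact this.symm
  refine ⟨⟨Hausdorff.mellinUnitary e hC, Hausdorff.mulOp volume Φ,
      Hausdorff.isMellinTransform_mellinUnitary e hC, fun g ↦ ?_, hV⟩,
    ⟨Φ, hΦ, hspec.trans (Hausdorff.spectrum_mulOp_eq_spectrum volume Φ)⟩, ?_, fun z ↦ ?_, ?_⟩
  · filter_upwards [Hausdorff.coeFn_mulOp Φ g] with s hs
    rw [hs, hΦ']
  · rw [hspec, Hausdorff.spectrum_mulOp]
    simp only [hΦ']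
  · have := Hausdorff.isClosed_det_eq_zero (algebraMap ℂ _ z - Φ)
    simpa only [Hausdorff.evalMat_algebraMap_sub, hΦ'] using this
  · rw [Hausdorff.pointSpectrum_conj _ hV, Hausdorff.pointSpectrum_mulOp]
    simp only [hΦ']
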